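/- A \emph{bi-rooted dipole} is a 2-cell embedding, in a closed oriented surface, of a loopless graph with exactly two vertices, with a distinguished root vertex, a distinguished root edge and a distinguished secondary edge different from the root edge, taken up to orientation-preserving homeomorphism respecting these choices; let $\widehat{\mathcal D}$ be the set of bi-rooted dipoles. At the root vertex, Region 1 is swept counterclockwise from the root edge to the secondary edge, and Region 2 is its complement; at the other vertex, Region 3 is swept counterclockwise from the root edge to the secondary edge, and Region 4 is its complement. An edge other than the root and secondary edges is an $a$-, $b$-, $c$- or $d$-edge if its ends are in Regions 2 and 3, 1 and 3, 2 and 4, or 1 and 4, respectively; $\alpha(D),\beta(D),\gamma(D),\delta(D)$ are the numbers of such edges of $D$, and $g(D)$ is the genus of the surface. Mark each corner at the root vertex by $\bullet$ if it lies in Region 1 and by $\circ$ if it lies in Region 2. The root face is the one containing the corner that follows the root edge counterclockwise at the root vertex (the root corner). Let $R(D)\in\{\bullet,\circ\}^*$ be the string of marks met on the counterclockwise boundary walk of the root face starting at the root corner, and let $\Lambda(D)$ be the multiset of the cyclic binary strings met on the counterclockwise boundary walks of the non-root faces. Here the cyclic binary string $(S)$ is the multiset of the $\ell(S)$ cyclic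 shifts of the binary string $S$ of length $\ell(S)$. Let $K$ be a field of characteristic $0$. Take indeterminates $g_S$ indexed by binary strings $S$ and $f_{(S)}$ indexed by cyclic binary strings $(S)$, put $f_{\Lambda(D)}=\prod_{(S)\in\Lambda(D)}f_{(S)}$, and consider formal power series in $x,y,v,w,u$ whose coefficients are polynomials over $K$ in the $g_S$ and $f_{(S)}$. Define the $(a,b,c,d)$-dipole series \[\Gamma=\sum_{D\in\widehat{\mathcal D}}\frac{x^{\alpha(D)+1}}{(\alpha(D)+1)!}\frac{y^{\beta(D)}}{\beta(D)!}\frac{v^{\gamma(D)+\delta(D)}}{(\gamma(D)+\delta(D))!}\,w^{\delta(D)}u^{2g(D)}g_{R(D)}f_{\Lambda(D)}\] and the $(a,b,0,0)$-dipole series \[B=\sum_{\substack{D\in\widehat{\mathcal D}\\ \gamma(D)=\delta(D)=0}}\frac{x^{\alpha(D)+1}}{(\alpha(D)+1)!}\frac{y^{\beta(D)}}{\beta(D)!}\,u^{2g(D)}g_{R(D)}f_{\Lambda(D)}.\] Define the cut and join operators \[C''=\sum_{R}\Bigl(\sum_{2\le i\le \ell(R)}w^{\delta_{R_i,\bullet}}g_{R_1R_i\cdots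 R_{\ell(R)}}f_{(R_2\cdots R_i)}+w\,g_{R_1}f_{(R)}\Bigr)\frac{\partial}{\partial g_R},\] \[J''=\sum_{R}\sum_{(S)}\Bigl(\sum_{S_1\cdots S_{\ell(S)}\in(S)}w^{\delta_{S_1,\bullet}}g_{R_1S_1\cdots S_{\ell(S)}S_1R_2\cdots R_{\ell(R)}}\Bigr)\frac{\partial^2}{\partial g_R\,\partial f_{(S)}},\] where $R$ runs over the nonempty binary strings, $(S)$ runs over the nonempty cyclic binary strings, and the sum over $S_1\cdots S_{\ell(S)}\in(S)$ is over the multiset $(S)$, with multiplicity. \textbf{Theorem.} The series $\Gamma$ is the unique formal power series (of the above kind) that satisfies the formal partial differential equation \[(C''+u^2J'')\,\Gamma=\frac{\partial\Gamma}{\partial v}\] with initial condition $\Gamma|_{v=0}=B$. -/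

import Mathlib

noncomputable section

namespace DipoleSeries

/-! ### Bi-rooted dipoles -/

/-- A bi-rooted dipole with edge set `E`: a loopless 2-cell embedding, in an oriented surface, of a
graph with exactly two vertices (so that every edge joins the two), with a distinguished root
vertex, a root edge and a second distinguished edge, given by its rotation system.
`rotRoot x` (resp. `rotNon x`) is the edge that follows `x` counterclockwise around the root vertex
(resp. around the non-root vertex). -/
structure BirootedDipole (E : Type) where
  rotRoot : Equiv.Perm E
  rotNon : Equiv.Perm E
  root : E
  second : E
  rotRoot_cycle : rotRoot.IsCycleOn Set.univ
  rotNon_cycle : rotNon.IsCycleOn Set.univ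
  root_ne_second : root ≠ second

/-- Number of steps `k` of the rotation `σ` that lead for the first time from `r` to `x`. -/
def steps {E : Type} (σ : Equiv.Perm E) (r x : E) : ℕ := sInf {k : ℕ | (σ ^ k) r = x}

/-- Isomorphism of bi-rooted dipoles: orientation-preserving homeomorphisms that preserve the root
vertex, the root edge and the secondary edge, in terms of rotation systems. -/
structure DipoleIso {E E' : Type} (D : BirootedDipole E) (D' : BirootedDipole E') where
  toEquiv : E ≃ E'
  map_rotRoot : ∀ x, toEquiv (D.rotRoot x) = D'.rotRoot (toEquiv x)
  map_rotNon : ∀ x, toEquiv (D.rotNon x) = D'.rotNon (toEquiv x)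
  map_root : toEquiv D.root = D'.root
  map_second : toEquiv D.second = D'.second

namespace BirootedDipole

variable {E : Type} (D : BirootedDipole E)

/-- An ordinary edge is one that is neither the root edge nor the secondary edge. -/
def IsOrdinary (x : E) : Prop := x ≠ D.root ∧ x ≠ D.second

/-- The ordinary edge `x` leaves the root vertex through Region 1, the region swept
counterclockwise around the root vertex from the root edge to the secondary edge; otherwise it
does so through the complementary Region 2. -/
def ThroughRegion1 (x : E) : Prop :=
  steps D.rotRoot D.root x < steps D.rotRoot D.root D.second

/-- The ordinary edge `x` reaches the non-root vertex through Region 3, the region swept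
counterclockwise around the non-root vertex from the root edge to the secondary edge; otherwise it
does so through the complementary Region 4. -/
def ThroughRegion3 (x : E) : Prop :=
  steps D.rotNon D.root x < steps D.rotNon D.root D.second

/-- Number of `a`-edges: ordinary edges with ends in Regions 2 and 3. -/
def numA : ℕ := Nat.card {x : E // D.IsOrdinary x ∧ ¬ D.ThroughRegion1 x ∧ D.ThroughRegion3 x}

/-- Number of `b`-edges: ordinary edges with ends in Regions 1 and 3. -/
def numB : ℕ := Nat.card {x : E // D.IsOrdinary x ∧ D.ThroughRegion1 x ∧ D.ThroughRegion3 x}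

/-- Number of `c`-edges: ordinary edges with ends in Regions 2 and 4. -/
def numC : ℕ := Nat.card {x : E // D.IsOrdinary x ∧ ¬ D.ThroughRegion1 x ∧ ¬ D.ThroughRegion3 x}

/-- Number of `d`-edges: ordinary edges with ends in Regions 1 and 4. -/
def numD : ℕ := Nat.card {x : E // D.IsOrdinary x ∧ D.ThroughRegion1 x ∧ ¬ D.ThroughRegion3 x}

/-- The corners at the root vertex are indexed by edges: corner `x` lies between the edge `x` and
its counterclockwise successor. The marking of a corner is `true` (a black dot) if the
corner lies in Region 1 and `false` (a white dot) if it lies in Region 2. -/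
def mark (x : E) : Bool :=
  decide (steps D.rotRoot D.root x < steps D.rotRoot D.root D.second)

/-- The boundary walk that keeps the face on its left (counterclockwise): from the corner `x` at
the root vertex go along the edge `x`, at the non-root vertex turn to the edge clockwise next to
`x`, follow it back to the root vertex, and enter the corner on its clockwise side. -/
def faceStep : Equiv.Perm E := D.rotRoot⁻¹ * D.rotNon⁻¹

/-- The faces: cycles (fixed points included) of the face permutation. -/
def Face : Type := Quotient (Equiv.Perm.SameCycle.setoid D.faceStep)

/-- The face that contains the corner `x`. -/
def faceAt (x : E) : D.Face := Quotient.mk (Equiv.Perm.SameCycle.setoid D.faceStep) x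

/-- The root face; the root corner is the corner that follows the root edge counterclockwise. -/
def rootFace : D.Face := D.faceAt D.root

/-- The genus, from Euler's formula `2 - n + m = 2 - 2 g`, where `n` is the number of edges and
`m` is the number of faces. -/
def genus : ℕ := (Nat.card E - Nat.card D.Face) / 2

/-- The binary string `R(D)`: the marks met on the counterclockwise boundary walk of the root face
that starts at the root corner. -/
def rootString : List Bool :=
  (List.range (Function.minimalPeriod D.faceStep D.root)).map fun i => D.mark (D.faceStep^[i] D.root)

/-- The cyclic string of marks around the face of the corner `x` depends only on the face. -/
theorem cyclicMarks_eq [Finite E] {x y : E} (h : D.faceStep.SameCycle x y) :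
    (Function.periodicOrbit D.faceStep x).map D.mark =
      (Function.periodicOrbit D.faceStep y).map D.mark := by
  obtain ⟨n, hn⟩ := h.exists_nat_pow_eq
  have hx : x ∈ Function.periodicPts D.faceStep :=
    Function.Injective.mem_periodicPts D.faceStep.injective x
  rw [← hn, ← Equiv.Perm.iterate_eq_pow, Function.periodicOrbit_apply_iterate_eq hx]

/-- The cyclic binary string met on the counterclockwise boundary walk of a face. -/
def faceString [Finite E] (F : D.Face) : Cycle Bool :=
  Quotient.liftOn F (fun x => (Function.periodicOrbit D.faceStep x).map D.mark)
    fun _ _ h => D.cyclicMarks_eq h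

instance [Finite E] : Finite D.Face :=
  inferInstanceAs (Finite (Quotient (Equiv.Perm.SameCycle.setoid D.faceStep)))

/-- The multiset `Λ(D)` of the cyclic binary strings of the non-root faces. -/
def nonrootStrings [Finite E] : Multiset (Cycle Bool) :=
  letI : Fintype {F : D.Face // F ≠ D.rootFace} := Fintype.ofFinite _
  (Finset.univ : Finset {F : D.Face // F ≠ D.rootFace}).val.map fun F => D.faceString F.1

end BirootedDipole

/-! ### Invariance under isomorphism -/

namespace DipoleIso

variable {E E' : Type} {D : BirootedDipole E} {D' : BirootedDipole E'}

def refl (D : BirootedDipole E) : DipoleIso D D :=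
  ⟨Equiv.refl E, fun _ => rfl, fun _ => rfl, rfl, rfl⟩

def symm (e : DipoleIso D D') : DipoleIso D' D where
  toEquiv := e.toEquiv.symm
  map_rotRoot x := by rw [Equiv.symm_apply_eq, e.map_rotRoot, Equiv.apply_symm_apply]
  map_rotNon x := by rw [Equiv.symm_apply_eq, e.map_rotNon, Equiv.apply_symm_apply]
  map_root := by rw [Equiv.symm_apply_eq, e.map_root]
  map_second := by rw [Equiv.symm_apply_eq, e.map_second]

def trans {E'' : Type} {D'' : BirootedDipole E''} (e : DipoleIso D D') (e' : DipoleIso D' D'') :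
    DipoleIso D D'' where
  toEquiv := e.toEquiv.trans e'.toEquiv
  map_rotRoot x := by simp [e.map_rotRoot, e'.map_rotRoot]
  map_rotNon x := by simp [e.map_rotNon, e'.map_rotNon]
  map_root := by simp [e.map_root, e'.map_root]
  map_second := by simp [e.map_second, e'.map_second]

theorem steps_eq (π : E ≃ E') {σ : Equiv.Perm E} {σ' : Equiv.Perm E'}
    (h : ∀ x, π (σ x) = σ' (π x)) (r x : E) : steps σ' (π r) (π x) = steps σ r x := by
  have key : ∀ k : ℕ, (σ' ^ k) (π r) = π ((σ ^ k) r) := by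
    intro k
    induction k with
    | zero => rfl
    | succ k ih => rw [pow_succ', pow_succ', Equiv.Perm.mul_apply, Equiv.Perm.mul_apply, ih, h]
  simp only [steps, key, π.injective.eq_iff]

theorem isOrdinary_iff (e : DipoleIso D D') (x : E) : D.IsOrdinary x ↔ D'.IsOrdinary (e.toEquiv x) := by
  simp only [BirootedDipole.IsOrdinary, ← e.map_root, ← e.map_second, ne_eq,
    e.toEquiv.injective.eq_iff]

theorem throughRegion1_iff (e : DipoleIso D D') (x : E) : D.ThroughRegion1 x ↔ D'.ThroughRegion1 (e.toEquiv x) := by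
  simp only [BirootedDipole.ThroughRegion1, ← e.map_root, ← e.map_second,
    steps_eq e.toEquiv e.map_rotRoot]

theorem throughRegion3_iff (e : DipoleIso D D') (x : E) : D.ThroughRegion3 x ↔ D'.ThroughRegion3 (e.toEquiv x) := by
  simp only [BirootedDipole.ThroughRegion3, ← e.map_root, ← e.map_second,
    steps_eq e.toEquiv e.map_rotNon]

theorem numA_eq (e : DipoleIso D D') : D.numA = D'.numA :=
  Nat.card_congr <| e.toEquiv.subtypeEquiv fun x => by
    rw [e.isOrdinary_iff, e.throughRegion1_iff, e.throughRegion3_iff]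

theorem numB_eq (e : DipoleIso D D') : D.numB = D'.numB :=
  Nat.card_congr <| e.toEquiv.subtypeEquiv fun x => by
    rw [e.isOrdinary_iff, e.throughRegion1_iff, e.throughRegion3_iff]

theorem numC_eq (e : DipoleIso D D') : D.numC = D'.numC :=
  Nat.card_congr <| e.toEquiv.subtypeEquiv fun x => by
    rw [e.isOrdinary_iff, e.throughRegion1_iff, e.throughRegion3_iff]

theorem numD_eq (e : DipoleIso D D') : D.numD = D'.numD :=
  Nat.card_congr <| e.toEquiv.subtypeEquiv fun x => by
    rw [e.isOrdinary_iff, e.throughRegion1_iff, e.throughRegion3_iff]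

theorem mark_eq (e : DipoleIso D D') (x : E) : D'.mark (e.toEquiv x) = D.mark x := by
  simp only [BirootedDipole.mark, ← e.map_root, ← e.map_second, steps_eq e.toEquiv e.map_rotRoot]

theorem faceStep_eq (e : DipoleIso D D') (x : E) :
    e.toEquiv (D.faceStep x) = D'.faceStep (e.toEquiv x) := by
  simp only [BirootedDipole.faceStep, Equiv.Perm.mul_apply]
  rw [Equiv.Perm.eq_inv_iff_eq, ← e.map_rotRoot, Equiv.Perm.eq_inv_iff_eq, ← e.map_rotNon]
  simp

theorem iterate_eq (e : DipoleIso D D') (i : ℕ) (x : E) :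
    D'.faceStep^[i] (e.toEquiv x) = e.toEquiv (D.faceStep^[i] x) := by
  induction i with
  | zero => rfl
  | succ i ih => rw [Function.iterate_succ_apply', Function.iterate_succ_apply', ih, e.faceStep_eq]

theorem minimalPeriod_eq (e : DipoleIso D D') (x : E) :
    Function.minimalPeriod D'.faceStep (e.toEquiv x) = Function.minimalPeriod D.faceStep x := by
  rw [Function.minimalPeriod_eq_minimalPeriod_iff]
  intro n
  simp only [Function.IsPeriodicPt, Function.IsFixedPt, e.iterate_eq, e.toEquiv.injective.eq_iff]

theorem rootString_eq (e : DipoleIso D D') : D.rootString = D'.rootString := by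
  simp only [BirootedDipole.rootString, ← e.map_root, e.minimalPeriod_eq, e.iterate_eq, e.mark_eq]

theorem sameCycle_iff (e : DipoleIso D D') (x y : E) :
    D.faceStep.SameCycle x y ↔ D'.faceStep.SameCycle (e.toEquiv x) (e.toEquiv y) := by
  have key : D'.faceStep = e.toEquiv.permCongrHom D.faceStep := by
    ext z
    simp [e.faceStep_eq]
  simp only [Equiv.Perm.SameCycle, key, ← map_zpow]
  simp

/-- The bijection between the faces of two isomorphic dipoles. -/
def faceEquiv (e : DipoleIso D D') : D.Face ≃ D'.Face :=
  Quotient.congr e.toEquiv e.sameCycle_iff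

theorem card_edge_eq (e : DipoleIso D D') : Nat.card E = Nat.card E' := Nat.card_congr e.toEquiv

theorem genus_eq (e : DipoleIso D D') : D.genus = D'.genus := by
  simp only [BirootedDipole.genus, e.card_edge_eq, Nat.card_congr e.faceEquiv]

theorem faceEquiv_rootFace (e : DipoleIso D D') : e.faceEquiv D.rootFace = D'.rootFace := by
  have h : e.faceEquiv D.rootFace = D'.faceAt (e.toEquiv D.root) := rfl
  rw [h, e.map_root]
  rfl

theorem faceString_eq [Finite E] [Finite E'] (e : DipoleIso D D') (F : D.Face) :
    D'.faceString (e.faceEquiv F) = D.faceString F := by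
  induction F using Quotient.inductionOn with
  | h x =>
    change (Function.periodicOrbit D'.faceStep (e.toEquiv x)).map D'.mark =
      (Function.periodicOrbit D.faceStep x).map D.mark
    simp only [Function.periodicOrbit, Cycle.map_coe, List.map_map, e.minimalPeriod_eq]
    congr 2
    funext i
    simp only [Function.comp_apply, e.iterate_eq, e.mark_eq]

theorem nonrootStrings_eq [Finite E] [Finite E'] (e : DipoleIso D D') :
    D.nonrootStrings = D'.nonrootStrings := by
  let : Fintype {F : D.Face // F ≠ D.rootFace} := Fintype.ofFinite _
  let : Fintype {F : D'.Face // F ≠ D'.rootFace} := Fintype.ofFinite _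
  let f : {F : D.Face // F ≠ D.rootFace} ≃ {F : D'.Face // F ≠ D'.rootFace} :=
    e.faceEquiv.subtypeEquiv fun F => by
      rw [← e.faceEquiv_rootFace, ne_eq, ne_eq, e.faceEquiv.injective.eq_iff]
  have h := Multiset.map_univ_val_equiv f
  change Multiset.map _ (Finset.univ : Finset {F : D.Face // F ≠ D.rootFace}).val =
    Multiset.map _ (Finset.univ : Finset {F : D'.Face // F ≠ D'.rootFace}).val
  rw [← h, Multiset.map_map]
  exact Multiset.map_congr rfl fun F _ => (e.faceString_eq F.1).symm

end DipoleIso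

/-! ### Isomorphism classes -/

/-- Bi-rooted dipoles with edge set `Fin n`, up to isomorphism. -/
def birootedSetoid (n : ℕ) : Setoid (BirootedDipole (Fin n)) where
  r D D' := Nonempty (DipoleIso D D')
  iseqv := ⟨fun D => ⟨DipoleIso.refl D⟩, fun ⟨e⟩ => ⟨e.symm⟩, fun ⟨e⟩ ⟨e'⟩ => ⟨e.trans e'⟩⟩

/-- The set of all bi-rooted dipoles (with any number `D.1` of edges). -/
def Birooted : Type := Σ n : ℕ, Quotient (birootedSetoid n)

namespace Birooted

/-- Number of `a`-edges. -/
def α (D : Birooted) : ℕ :=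
  Quotient.lift (s := birootedSetoid D.1) (fun D => D.numA) (fun _ _ ⟨e⟩ => e.numA_eq) D.2

/-- Number of `b`-edges. -/
def β (D : Birooted) : ℕ :=
  Quotient.lift (s := birootedSetoid D.1) (fun D => D.numB) (fun _ _ ⟨e⟩ => e.numB_eq) D.2

/-- Number of `c`-edges. -/
def γ (D : Birooted) : ℕ :=
  Quotient.lift (s := birootedSetoid D.1) (fun D => D.numC) (fun _ _ ⟨e⟩ => e.numC_eq) D.2

/-- Number of `d`-edges. -/
def δ (D : Birooted) : ℕ :=
  Quotient.lift (s := birootedSetoid D.1) (fun D => D.numD) (fun _ _ ⟨e⟩ => e.numD_eq) D.2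

/-- Genus of the surface. -/
def genus (D : Birooted) : ℕ :=
  Quotient.lift (s := birootedSetoid D.1) (fun D => D.genus) (fun _ _ ⟨e⟩ => e.genus_eq) D.2

/-- The binary string `R(D)` of the root face. -/
def R (D : Birooted) : List Bool :=
  Quotient.lift (s := birootedSetoid D.1) (fun D => D.rootString) (fun _ _ ⟨e⟩ => e.rootString_eq) D.2

/-- The multiset `Λ(D)` of the cyclic binary strings of the non-root faces. -/
def Λ (D : Birooted) : Multiset (Cycle Bool) :=
  Quotient.lift (s := birootedSetoid D.1) (fun D => D.nonrootStrings) (fun _ _ ⟨e⟩ => e.nonrootStrings_eq) D.2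

end Birooted

/-! ### Formal power series -/

/-- The variables in which the series are formal power series. -/
inductive Var
  | x | y | v | w | u

/-- The indeterminates `g_S` (`S` a binary string) and `f_(S)` (`(S)` a cyclic binary string). -/
inductive Indet
  | g (S : List Bool)
  | f (S : Cycle Bool)

variable (K : Type*) [Field K]

/-- Formal power series in `x, y, v, w, u` whose coefficients are polynomials in the
indeterminates `g_S` and `f_(S)`. -/
abbrev Series : Type _ := MvPowerSeries Var (MvPolynomial Indet K)

/-- A variable, as a series. -/
def var (i : Var) : Series K := MvPowerSeries.X i

/-- The indeterminate `g_S`, as a series. -/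
def gg (S : List Bool) : Series K := MvPowerSeries.C (MvPolynomial.X (Indet.g S))

/-- The indeterminate `f_(S)`, as a series. -/
def ff (S : Cycle Bool) : Series K := MvPowerSeries.C (MvPolynomial.X (Indet.f S))

/-- A rational number `1 / k`, as a series. -/
def invNat (k : ℕ) : Series K := MvPowerSeries.C (MvPolynomial.C ((k : K)⁻¹))

/-- The term of `D` in the `(a,b,c,d)`-dipole series. -/
def gammaTerm (D : Birooted) : Series K :=
  invNat K (D.α + 1).factorial * var K .x ^ (D.α + 1) *
    (invNat K D.β.factorial * var K .y ^ D.β) *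
    (invNat K (D.γ + D.δ).factorial * var K .v ^ (D.γ + D.δ)) *
    var K .w ^ D.δ * var K .u ^ (2 * D.genus) * gg K D.R * (D.Λ.map (ff K)).prod

/-- The `(a,b,c,d)`-dipole series: the sum of `gammaTerm` over all bi-rooted dipoles, coefficient by
coefficient (only finitely many dipoles contribute to each coefficient). -/
def Gam : Series K := fun e => ∑ᶠ D : Birooted, MvPowerSeries.coeff e (gammaTerm K D)

/-- The term of `D` in the `(a,b,0,0)`-dipole series. -/
def bTerm (D : Birooted) : Series K :=
  invNat K (D.α + 1).factorial * var K .x ^ (D.α + 1) *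
    (invNat K D.β.factorial * var K .y ^ D.β) *
    var K .u ^ (2 * D.genus) * gg K D.R * (D.Λ.map (ff K)).prod

/-- The `(a,b,0,0)`-dipole series: the sum of `bTerm` over all bi-rooted dipoles without `c`-edges
and `d`-edges. -/
def Bser : Series K := fun e =>
  ∑ᶠ D : {D : Birooted // D.γ = 0 ∧ D.δ = 0}, MvPowerSeries.coeff e (bTerm K D.1)

variable {K}

/-- Formal partial derivative with respect to an indeterminate `g_S` or `f_(S)`. -/
def dIndet (i : Indet) (F : Series K) : Series K := fun e =>
  MvPolynomial.pderiv i (MvPowerSeries.coeff e F)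

/-- Formal partial derivative with respect to `v`. -/
def dv (F : Series K) : Series K := fun e =>
  (e Var.v + 1) • MvPowerSeries.coeff (e + Finsupp.single Var.v 1) F

/-- The evaluation `F|_{v=0}`. -/
def atV0 (F : Series K) : Series K := fun e =>
  if e Var.v = 0 then MvPowerSeries.coeff e F else 0

variable (K)

/-- The factor `w ^ δ_{s,•}`. -/
def wpow (s : Bool) : Series K := if s = true then var K .w else 1

/-- The coefficient of `∂/∂g_R` in the cut operator. For `R = R₁ R₂ ⋯ R_ℓ = r :: t` the summation
index `2 ≤ i ≤ ℓ` is `j + 2`, so that `R_i = t[j]`, `R_i ⋯ R_ℓ = t.drop j` and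
`R₂ ⋯ R_i = t.take (j + 1)`. The empty string does not contribute. -/
def cutCoeff : List Bool → Series K
  | [] => 0
  | r :: t =>
    (∑ j : Fin t.length,
      wpow K (t.get j) * gg K (r :: t.drop (j : ℕ)) * ff K (t.take ((j : ℕ) + 1) : List Bool)) +
    var K .w * gg K [r] * ff K (r :: t : List Bool)

/-- The contribution of `R` and of the representative `S` of a cyclic string to the join operator:
`w ^ δ_{S₁,•} g_{R₁ S₁ ⋯ S_ℓ S₁ R₂ ⋯ R_ℓ}`. Empty strings do not contribute. -/
def joinTerm : List Bool → List Bool → Series K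
  | r :: t, s :: S => wpow K s * gg K (r :: (s :: S) ++ s :: t)
  | _, _ => 0

/-- The coefficient of `∂²/∂g_R ∂f_(S)` in the join operator: the sum over the multiset of the
cyclic shifts of `S`. -/
def joinCoeff (R : List Bool) (S : Cycle Bool) : Series K :=
  (S.lists.map (joinTerm K R)).sum

variable {K}

/-- The cut operator `C''`. In each coefficient only finitely many terms are nonzero. -/
def cutOp (F : Series K) : Series K := fun e =>
  ∑ᶠ R : List Bool, MvPowerSeries.coeff e (cutCoeff K R * dIndet (.g R) F)

/-- The join operator `J''`. In each coefficient only finitely many terms are nonzero. -/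
def joinOp (F : Series K) : Series K := fun e =>
  ∑ᶠ p : List Bool × Cycle Bool,
    MvPowerSeries.coeff e (joinCoeff K p.1 p.2 * dIndet (.g p.1) (dIndet (.f p.2) F))

/-- The formal partial differential equation `(C'' + u² J'') F = ∂F/∂v` with initial condition
`F|_{v=0} = B`. -/
def IsSolution (F : Series K) : Prop :=
  cutOp F + var K .u ^ 2 * joinOp F = dv F ∧ atV0 F = Bser K

end DipoleSeries

end

noncomputable section

namespace DipoleSeries

/-! ### Rotations and step counts -/

section Rotation

variable {E : Type}

/-! Differentiation in `v` deletes one canonical edge. If a dipole has a `c`- or `d`-edge, then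
Region 4 contains an edge, and the edge just before the root edge at the non-root vertex is neither
the root edge nor the secondary edge. It can be removed. Conversely, a new edge can be put just
before the root edge at the non-root vertex and into any corner `x` of the root vertex
(`BirootedDipole.insert`). A rooted dipole has no nontrivial automorphism, so different corners give
different classes. Thus `Birooted.extend` is a bijection from pairs (dipole, corner) to the dipoles
with `γ + δ ≠ 0` (`extend_injective`, `exists_extend_eq`). Since `v` is an exponential variable, the
derivative of the term of the larger dipole has the scalar weight of the smaller one, with a factor
`w` if the corner is black.

The effect on faces is local: the face permutation receives a new arrow from the root edge to `x`,
while the old arrow out of the root edge and the old arrow into `x` are attached to the new edge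
(`isCutJoin_insert`). If `x` lies on the root face, that face is cut in two and the genus is
unchanged (`insert_root`, `insert_cut`). If `x` lies on another face, that face is joined to the
root face and the genus grows by one (`insert_join`). Summing over the corners of a fixed dipole
gives exactly `C'' + u² J''` applied to its term (`sum_dv_gammaTerm_extend`).

To pass to the infinite series, each coefficient is computed from dipoles with boundedly many edges.
Uniqueness holds because the equation determines the coefficients of degree `n + 1` in `v` from
those of degree at most `n`, in characteristic zero. -/

theorem perm_apply_inv (σ : Equiv.Perm E) (x : E) : σ (σ⁻¹ x) = x := σ.apply_symm_apply x

theorem perm_inv_apply (σ : Equiv.Perm E) (x : E) : σ⁻¹ (σ x) = x := σ.symm_apply_apply x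

theorem isCycleOn_univ_iff {σ : Equiv.Perm E} :
    σ.IsCycleOn Set.univ ↔ ∀ x y, σ.SameCycle x y :=
  ⟨fun h x y => h.2 (Set.mem_univ x) (Set.mem_univ y),
    fun h => ⟨by simpa using σ.bijective.bijOn_univ, fun x _ y _ => h x y⟩⟩

theorem exists_pow_eq [Finite E] {σ : Equiv.Perm E} (hσ : σ.IsCycleOn Set.univ) (r x : E) :
    ∃ k : ℕ, (σ ^ k) r = x :=
  (isCycleOn_univ_iff.1 hσ r x).exists_nat_pow_eq

theorem steps_self (σ : Equiv.Perm E) (r : E) : steps σ r r = 0 :=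
  Nat.sInf_eq_zero.2 (Or.inl rfl)

theorem pow_steps [Finite E] {σ : Equiv.Perm E} (hσ : σ.IsCycleOn Set.univ) (r x : E) :
    (σ ^ steps σ r x) r = x :=
  Nat.sInf_mem (exists_pow_eq hσ r x)

theorem steps_injective [Finite E] {σ : Equiv.Perm E} (hσ : σ.IsCycleOn Set.univ) (r : E) :
    Function.Injective (steps σ r) := fun x y h => by
  rw [← pow_steps hσ r x, h, pow_steps hσ]

theorem steps_apply [Finite E] {σ : Equiv.Perm E} (hσ : σ.IsCycleOn Set.univ) {r x : E}
    (hx : σ x ≠ r) : steps σ r (σ x) = steps σ r x + 1 := by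
  apply le_antisymm
  · apply Nat.sInf_le
    change (σ ^ (steps σ r x + 1)) r = σ x
    rw [pow_succ', Equiv.Perm.mul_apply, pow_steps hσ]
  · have h := pow_steps hσ r (σ x)
    cases hm : steps σ r (σ x) with
    | zero =>
      rw [hm] at h
      exact absurd h.symm hx
    | succ m =>
      rw [hm, pow_succ', Equiv.Perm.mul_apply, σ.injective.eq_iff] at h
      exact Nat.succ_le_succ (Nat.sInf_le h)

/-- Along the cycle from `r`, both functions start at 0 and grow by one until the cycle closes. A
formula for step counts thus needs checking on single steps only. -/
theorem eq_steps [Finite E] {σ : Equiv.Perm E} (hσ : σ.IsCycleOn Set.univ) {r : E} {f : E → ℕ}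
    (h0 : f r = 0) (h1 : ∀ x, σ x ≠ r → f (σ x) = f x + 1) (x : E) : steps σ r x = f x := by
  induction h : steps σ r x generalizing x with
  | zero =>
    have := pow_steps hσ r x
    rw [h] at this
    rw [← this]
    exact h0.symm
  | succ k ih =>
    have hx : σ (σ⁻¹ x) ≠ r := by
      rintro h'
      rw [perm_apply_inv] at h'
      rw [h', steps_self] at h
      omega
    have h2 := steps_apply hσ hx
    have h3 := h1 _ hx
    rw [perm_apply_inv] at h2 h3
    rw [h3, ← ih (σ⁻¹ x) (by omega)]

open Classical in
/-- The rotation obtained from `σ` by inserting the new point `none` immediately after `x`. -/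
def insertAfter (σ : Equiv.Perm E) (x : E) : Equiv.Perm (Option E) :=
  Equiv.optionCongr σ * Equiv.swap none (some x)

@[simp]
theorem insertAfter_none (σ : Equiv.Perm E) (x : E) : insertAfter σ x none = some (σ x) := by
  simp [insertAfter]

@[simp]
theorem insertAfter_self (σ : Equiv.Perm E) (x : E) : insertAfter σ x (some x) = none := by
  simp [insertAfter]

theorem insertAfter_of_ne (σ : Equiv.Perm E) {x y : E} (h : y ≠ x) :
    insertAfter σ x (some y) = some (σ y) := by
  simp [insertAfter, Equiv.swap_apply_of_ne_of_ne, h]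

theorem insertAfter_inv_none (σ : Equiv.Perm E) (x : E) : (insertAfter σ x)⁻¹ none = some x := by
  rw [Equiv.Perm.inv_eq_iff_eq, insertAfter_self]

theorem insertAfter_inv_apply (σ : Equiv.Perm E) (x : E) :
    (insertAfter σ x)⁻¹ (some (σ x)) = none := by
  rw [Equiv.Perm.inv_eq_iff_eq, insertAfter_none]

theorem insertAfter_inv_of_ne (σ : Equiv.Perm E) {x y : E} (h : y ≠ σ x) :
    (insertAfter σ x)⁻¹ (some y) = some (σ⁻¹ y) := by
  rw [Equiv.Perm.inv_eq_iff_eq, insertAfter_of_ne, perm_apply_inv]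
  rintro rfl
  exact h (perm_apply_inv σ y).symm

/-- Composing with the swap of `none` and `some x` makes `none` a fixed point, which can then be
removed. -/
theorem exists_eq_insertAfter (τ : Equiv.Perm (Option E)) {x : E} (h : τ (some x) = none) :
    ∃ σ : Equiv.Perm E, τ = insertAfter σ x := by
  classical
  set ρ : Equiv.Perm (Option E) := τ * Equiv.swap none (some x) with hρ
  have h0 : ρ none = none := by simp [hρ, h]
  refine ⟨Equiv.removeNone ρ, ?_⟩
  have h1 : Equiv.optionCongr (Equiv.removeNone ρ) = ρ := by
    ext1 z
    cases z with
    | none => simp [h0]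
    | some y =>
      rw [Equiv.optionCongr_apply, Option.map_some, Equiv.removeNone_some]
      exact Option.ne_none_iff_exists'.1 fun h => by simpa using ρ.injective (h.trans h0.symm)
  rw [insertAfter, h1, hρ, mul_assoc, Equiv.swap_mul_self, mul_one]

theorem isCycleOn_insertAfter [Finite E] {σ : Equiv.Perm E} {x : E} :
    (insertAfter σ x).IsCycleOn Set.univ ↔ σ.IsCycleOn Set.univ := by
  have base : (insertAfter σ x).SameCycle (some x) none := ⟨1, by simp⟩
  constructor
  · intro h
    -- The default value `x` of `getD` collapses the new point onto its predecessor, so the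
    -- projected orbit moves by `σ` or stays put.
    have key : ∀ k : ℕ, σ.SameCycle x ((((insertAfter σ x) ^ k) (some x)).getD x) := by
      intro k
      induction k with
      | zero => exact Equiv.Perm.SameCycle.refl _ _
      | succ k ih =>
        rw [pow_succ', Equiv.Perm.mul_apply]
        cases hz : ((insertAfter σ x) ^ k) (some x) with
        | none => simpa using Equiv.Perm.SameCycle.refl σ x
        | some y =>
          rw [hz, Option.getD_some] at ih
          by_cases hy : y = x
          · subst hy
            rw [insertAfter_self]
            exact Equiv.Perm.SameCycle.refl σ y
          · rw [insertAfter_of_ne _ hy]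
            simpa using ih
    have key' : ∀ y, σ.SameCycle x y := by
      intro y
      obtain ⟨k, hk⟩ := exists_pow_eq h (some x) (some y)
      simpa [hk] using key k
    exact isCycleOn_univ_iff.2 fun y z => (key' y).symm.trans (key' z)
  · intro h
    have key : ∀ k : ℕ, (insertAfter σ x).SameCycle (some x) (some ((σ ^ k) x)) := by
      intro k
      induction k with
      | zero => exact Equiv.Perm.SameCycle.refl _ _
      | succ k ih =>
        rw [pow_succ', Equiv.Perm.mul_apply]
        by_cases hy : (σ ^ k) x = x
        · rw [hy, ← insertAfter_none, Equiv.Perm.sameCycle_apply_right]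
          exact base
        · rw [← insertAfter_of_ne _ hy, Equiv.Perm.sameCycle_apply_right]
          exact ih
    have key' : ∀ z, (insertAfter σ x).SameCycle (some x) z := by
      rintro (_ | y)
      · exact base
      · obtain ⟨k, rfl⟩ := exists_pow_eq h x y
        exact key k
    exact isCycleOn_univ_iff.2 fun y z => (key' y).symm.trans (key' z)

/-- The new point comes right after `x` and delays by one exactly the points beyond `x`; hence it
leaves the order of the old points unchanged. -/
theorem steps_insertAfter [Finite E] {σ : Equiv.Perm E} (hσ : σ.IsCycleOn Set.univ) (r x : E)
    (z : Option E) :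
    steps (insertAfter σ x) (some r) z = z.elim (steps σ r x + 1) fun y =>
      if steps σ r x < steps σ r y then steps σ r y + 1 else steps σ r y := by
  apply eq_steps (isCycleOn_insertAfter.2 hσ)
  · simp [steps_self]
  · rintro (_ | y) hz
    · rw [insertAfter_none] at hz ⊢
      have := steps_apply hσ (r := r) (x := x) (by rintro h; exact hz (by rw [h]))
      simp [this]
    · by_cases hy : y = x
      · subst hy
        simp
      · rw [insertAfter_of_ne _ hy] at hz ⊢
        have h1 := steps_apply hσ (r := r) (x := y) (by rintro h; exact hz (by rw [h]))
        have h2 := (steps_injective hσ r).ne hy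
        simp only [Option.elim_some, h1]
        split_ifs <;> omega

theorem steps_insertAfter_some_lt [Finite E] {σ : Equiv.Perm E} (hσ : σ.IsCycleOn Set.univ)
    (r x y z : E) :
    steps (insertAfter σ x) (some r) (some y) < steps (insertAfter σ x) (some r) (some z) ↔
      steps σ r y < steps σ r z := by
  simp only [steps_insertAfter hσ, Option.elim_some]
  split_ifs <;> omega

theorem steps_insertAfter_none_lt [Finite E] {σ : Equiv.Perm E} (hσ : σ.IsCycleOn Set.univ)
    (r x z : E) :
    steps (insertAfter σ x) (some r) none < steps (insertAfter σ x) (some r) (some z) ↔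
      steps σ r x < steps σ r z := by
  simp only [steps_insertAfter hσ, Option.elim_some, Option.elim_none]
  split_ifs <;> omega

/-- The predecessor of the root is the last point of a rotation. -/
theorem steps_le_steps_inv [Finite E] {σ : Equiv.Perm E} (hσ : σ.IsCycleOn Set.univ) (r x : E) :
    steps σ r x ≤ steps σ r (σ⁻¹ r) := by
  by_contra! h
  have h1 : (σ ^ (steps σ r (σ⁻¹ r) + 1)) r = r := by
    rw [pow_succ', Equiv.Perm.mul_apply, pow_steps hσ, perm_apply_inv]
  obtain ⟨m, hm⟩ := Nat.exists_eq_add_of_lt h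
  -- Dropping the full turn that ends at `r` would reach `x` in fewer steps.
  have h2 : (σ ^ m) r = x := by
    conv_rhs => rw [← pow_steps hσ r x, hm, show steps σ r (σ⁻¹ r) + m + 1 =
      m + (steps σ r (σ⁻¹ r) + 1) by ring, pow_add, Equiv.Perm.mul_apply, h1]
  have h3 : steps σ r x ≤ m := Nat.sInf_le h2
  omega

end Rotation

/-! ### Insertion of an edge next to the root edge -/

open Classical in
theorem card_option_subtype {E : Type} [Finite E] (P : Option E → Prop) :
    Nat.card {z // P z} = Nat.card {y // P (some y)} + if P none then 1 else 0 := by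
  have := Fintype.ofFinite E
  rw [Nat.card_eq_fintype_card, Nat.card_eq_fintype_card, Fintype.card_subtype,
    Fintype.card_subtype, Finset.card_filter, Finset.card_filter, Fintype.sum_option, add_comm]

namespace BirootedDipole

variable {E : Type}

/-- A new edge `none`, which follows the edge `x` at the root vertex and precedes the root edge at
the non-root vertex. -/
def insert [Finite E] (D : BirootedDipole E) (x : E) : BirootedDipole (Option E) where
  rotRoot := insertAfter D.rotRoot x
  rotNon := insertAfter D.rotNon (D.rotNon⁻¹ D.root)
  root := some D.root
  second := some D.second
  rotRoot_cycle := isCycleOn_insertAfter.2 D.rotRoot_cycle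
  rotNon_cycle := isCycleOn_insertAfter.2 D.rotNon_cycle
  root_ne_second := by simpa using D.root_ne_second

theorem mark_eq_true_iff (D : BirootedDipole E) (x : E) : D.mark x = true ↔ D.ThroughRegion1 x := by
  simp [mark, ThroughRegion1]

section Insert

variable [Finite E] (D : BirootedDipole E) (x : E)

theorem isOrdinary_insert_none : (D.insert x).IsOrdinary none := by
  simp [IsOrdinary, insert]

theorem isOrdinary_insert_some (y : E) : (D.insert x).IsOrdinary (some y) ↔ D.IsOrdinary y := by
  simp [IsOrdinary, insert]

theorem throughRegion1_insert_some (y : E) :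
    (D.insert x).ThroughRegion1 (some y) ↔ D.ThroughRegion1 y :=
  steps_insertAfter_some_lt D.rotRoot_cycle _ _ _ _

theorem throughRegion1_insert_none : (D.insert x).ThroughRegion1 none ↔ D.ThroughRegion1 x :=
  steps_insertAfter_none_lt D.rotRoot_cycle _ _ _

theorem throughRegion3_insert_some (y : E) :
    (D.insert x).ThroughRegion3 (some y) ↔ D.ThroughRegion3 y :=
  steps_insertAfter_some_lt D.rotNon_cycle _ _ _ _

/-- The new edge follows the last edge of the rotation at the non-root vertex, so it cannot precede
the secondary edge: it is always a `c`- or `d`-edge. -/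
theorem not_throughRegion3_insert_none : ¬ (D.insert x).ThroughRegion3 none := by
  rw [ThroughRegion3]
  refine (steps_insertAfter_none_lt D.rotNon_cycle _ _ _).not.2 ?_
  exact not_lt.2 (steps_le_steps_inv D.rotNon_cycle _ _)

theorem mark_insert_some (y : E) : (D.insert x).mark (some y) = D.mark y := by
  rw [Bool.eq_iff_iff, mark_eq_true_iff, mark_eq_true_iff, throughRegion1_insert_some]

/-- The new edge splits corner `x` into the corners `x` and `none`, which stay in the same region.
-/
theorem mark_insert_none : (D.insert x).mark none = D.mark x := by
  rw [Bool.eq_iff_iff, mark_eq_true_iff, mark_eq_true_iff, throughRegion1_insert_none]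

theorem numA_insert : (D.insert x).numA = D.numA := by
  rw [numA, card_option_subtype, if_neg fun h => D.not_throughRegion3_insert_none x h.2.2]
  simp only [isOrdinary_insert_some, throughRegion1_insert_some, throughRegion3_insert_some]
  rfl

theorem numB_insert : (D.insert x).numB = D.numB := by
  rw [numB, card_option_subtype, if_neg fun h => D.not_throughRegion3_insert_none x h.2.2]
  simp only [isOrdinary_insert_some, throughRegion1_insert_some, throughRegion3_insert_some]
  rfl

theorem numC_insert : (D.insert x).numC = D.numC + if D.mark x = true then 0 else 1 := by
  have h : ((D.insert x).IsOrdinary none ∧ ¬ (D.insert x).ThroughRegion1 none ∧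
      ¬ (D.insert x).ThroughRegion3 none) ↔ ¬ D.mark x = true := by
    rw [mark_eq_true_iff, throughRegion1_insert_none]
    exact ⟨fun h => h.2.1,
      fun h => ⟨D.isOrdinary_insert_none x, h, D.not_throughRegion3_insert_none x⟩⟩
  rw [numC, card_option_subtype]
  simp only [isOrdinary_insert_some, throughRegion1_insert_some, throughRegion3_insert_some, h]
  cases D.mark x <;> rfl

theorem numD_insert : (D.insert x).numD = D.numD + if D.mark x = true then 1 else 0 := by
  have h : ((D.insert x).IsOrdinary none ∧ (D.insert x).ThroughRegion1 none ∧
      ¬ (D.insert x).ThroughRegion3 none) ↔ D.mark x = true := by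
    rw [mark_eq_true_iff, throughRegion1_insert_none]
    exact ⟨fun h => h.2.1,
      fun h => ⟨D.isOrdinary_insert_none x, h, D.not_throughRegion3_insert_none x⟩⟩
  rw [numD, card_option_subtype]
  simp only [isOrdinary_insert_some, throughRegion1_insert_some, throughRegion3_insert_some, h]
  cases D.mark x <;> rfl

end Insert

/-- Relabelling of the edges. -/
def transport {E' : Type} (π : E ≃ E') (D : BirootedDipole E) : BirootedDipole E' where
  rotRoot := π.permCongrHom D.rotRoot
  rotNon := π.permCongrHom D.rotNon
  root := π D.root
  second := π D.second
  rotRoot_cycle := isCycleOn_univ_iff.2 fun x y => by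
    obtain ⟨n, hn⟩ := isCycleOn_univ_iff.1 D.rotRoot_cycle (π.symm x) (π.symm y)
    exact ⟨n, by rw [← map_zpow]; simp [hn]⟩
  rotNon_cycle := isCycleOn_univ_iff.2 fun x y => by
    obtain ⟨n, hn⟩ := isCycleOn_univ_iff.1 D.rotNon_cycle (π.symm x) (π.symm y)
    exact ⟨n, by rw [← map_zpow]; simp [hn]⟩
  root_ne_second := π.injective.ne D.root_ne_second

/-- The isomorphism from a dipole to its relabelling. -/
def transportIso {E' : Type} (π : E ≃ E') (D : BirootedDipole E) :
    DipoleIso D (D.transport π) where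
  toEquiv := π
  map_rotRoot x := by simp [transport]
  map_rotNon x := by simp [transport]
  map_root := rfl
  map_second := rfl

end BirootedDipole

theorem insertAfter_conj {E E' : Type} {σ : Equiv.Perm E} {σ' : Equiv.Perm E'} {x : E} {x' : E'}
    {e : Option E ≃ Option E'} {e₀ : E ≃ E'} (he : e none = none) (he₀ : ∀ y, e (some y) = some (e₀ y))
    (h : ∀ z, e (insertAfter σ x z) = insertAfter σ' x' (e z)) :
    e₀ x = x' ∧ ∀ y, e₀ (σ y) = σ' (e₀ y) := by
  have hx : e₀ x = x' := by
    have := h (some x)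
    rw [insertAfter_self, he, he₀, ← insertAfter_self σ' x', (insertAfter σ' x').injective.eq_iff,
      Option.some_inj] at this
    exact this.symm
  refine ⟨hx, fun y => ?_⟩
  rw [← Option.some_inj, ← he₀]
  by_cases hy : y = x
  · subst hy
    rw [← insertAfter_none, h, he, insertAfter_none, hx]
  · rw [← insertAfter_of_ne σ hy, h, he₀, insertAfter_of_ne]
    rw [← hx]
    exact e₀.injective.ne hy

theorem optionCongr_insertAfter {E E' : Type} {σ : Equiv.Perm E} {σ' : Equiv.Perm E'} (e : E ≃ E')
    (h : ∀ y, e (σ y) = σ' (e y)) {x : E} {x' : E'} (hx : e x = x') (z : Option E) :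
    Equiv.optionCongr e (insertAfter σ x z) = insertAfter σ' x' (Equiv.optionCongr e z) := by
  subst hx
  cases z with
  | none => simp [h]
  | some y =>
    by_cases hy : y = x
    · subst hy
      simp
    · rw [insertAfter_of_ne σ hy, Equiv.optionCongr_apply, Equiv.optionCongr_apply, Option.map_some,
        Option.map_some, insertAfter_of_ne σ' (e.injective.ne hy), h]

/-! ### Insertion and isomorphisms -/

namespace DipoleIso

variable {E E' : Type} {D : BirootedDipole E} {D' : BirootedDipole E'}

/-- An isomorphism of bi-rooted dipoles is determined by its source and target. -/
theorem toEquiv_apply_eq [Finite E] (e e' : DipoleIso D D') (x : E) : e.toEquiv x = e'.toEquiv x := by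
  obtain ⟨k, rfl⟩ := exists_pow_eq D.rotRoot_cycle D.root x
  induction k with
  | zero => simp [e.map_root, e'.map_root]
  | succ k ih => rw [pow_succ', Equiv.Perm.mul_apply, e.map_rotRoot, e'.map_rotRoot, ih]

theorem map_inv_rotNon_root (e : DipoleIso D D') :
    e.toEquiv (D.rotNon⁻¹ D.root) = D'.rotNon⁻¹ D'.root := by
  rw [Equiv.Perm.eq_inv_iff_eq, ← e.map_rotNon, perm_apply_inv, e.map_root]

variable [Finite E] [Finite E']

/-- Insertion of an edge is compatible with isomorphisms. -/
def insert (e : DipoleIso D D') (x : E) : DipoleIso (D.insert x) (D'.insert (e.toEquiv x)) where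
  toEquiv := Equiv.optionCongr e.toEquiv
  map_rotRoot := optionCongr_insertAfter _ e.map_rotRoot rfl
  map_rotNon := optionCongr_insertAfter _ e.map_rotNon e.map_inv_rotNon_root
  map_root := by simp [BirootedDipole.insert, e.map_root]
  map_second := by simp [BirootedDipole.insert, e.map_second]

/-- The new edge is recognisable as the predecessor of the root edge at the non-root vertex. Every
isomorphism therefore preserves it and restricts to the old edges. -/
theorem exists_of_insert {x : E} {x' : E'} (e : DipoleIso (D.insert x) (D'.insert x')) :
    ∃ e₀ : DipoleIso D D', e₀.toEquiv x = x' := by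
  have hr : e.toEquiv (some D.root) = some D'.root := e.map_root
  have hs : e.toEquiv (some D.second) = some D'.second := e.map_second
  have h0 : e.toEquiv none = none := by
    apply (D'.insert x').rotNon.injective
    rw [← e.map_rotNon]
    change e.toEquiv (insertAfter D.rotNon _ none) = insertAfter D'.rotNon _ none
    rw [insertAfter_none, insertAfter_none, perm_apply_inv, perm_apply_inv, hr]
  have hsome : ∀ y, e.toEquiv (some y) = some (Equiv.removeNone e.toEquiv y) := fun y => by
    rw [Equiv.removeNone_some]
    exact Option.ne_none_iff_exists'.1 fun h => by simpa using e.toEquiv.injective (h.trans h0.symm)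
  have h1 := insertAfter_conj h0 hsome e.map_rotRoot
  have h2 := insertAfter_conj h0 hsome e.map_rotNon
  exact ⟨⟨Equiv.removeNone e.toEquiv, h1.2, h2.2, by simpa [hsome] using hr,
    by simpa [hsome] using hs⟩, h1.1⟩

end DipoleIso

namespace BirootedDipole

variable {E : Type}

theorem rotNon_root_ne (D : BirootedDipole E) : D.rotNon D.root ≠ D.root := by
  intro h
  obtain ⟨n, hn⟩ := (isCycleOn_univ_iff.1 D.rotNon_cycle D.root D.second)
  rw [Equiv.Perm.zpow_apply_eq_self_of_apply_eq_self h] at hn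
  exact D.root_ne_second hn

variable [Finite E]

/-- A transitive rotation does not fix `none`, so `none` has an old edge as predecessor and can be
removed from each rotation. At the non-root vertex `h` forces that predecessor to be the one used by
`insert`. -/
theorem exists_eq_insert (D : BirootedDipole (Option E)) (h : D.rotNon none = D.root)
    (hr : D.root ≠ none) (hs : D.second ≠ none) :
    ∃ (D₀ : BirootedDipole E) (x : E), D = D₀.insert x := by
  obtain ⟨ρ, ν, r, s, hρ, hν, hrs⟩ := D
  obtain ⟨r, rfl⟩ := Option.ne_none_iff_exists'.1 hr
  obtain ⟨s, rfl⟩ := Option.ne_none_iff_exists'.1 hs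
  have key : ∀ τ : Equiv.Perm (Option E), τ.IsCycleOn Set.univ →
      ∃ (σ : Equiv.Perm E) (x : E), τ = insertAfter σ x := by
    intro τ hτ
    have hne : τ⁻¹ none ≠ none := by
      intro h'
      obtain ⟨n, hn⟩ := (isCycleOn_univ_iff.1 hτ none (some r))
      have : τ none = none := by
        rw [Equiv.Perm.inv_eq_iff_eq] at h'
        exact h'.symm
      rw [Equiv.Perm.zpow_apply_eq_self_of_apply_eq_self this] at hn
      simp at hn
    obtain ⟨x, hx⟩ := Option.ne_none_iff_exists'.1 hne
    rw [Equiv.Perm.inv_eq_iff_eq] at hx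
    obtain ⟨σ, hσ⟩ := exists_eq_insertAfter τ hx.symm
    exact ⟨σ, x, hσ⟩
  obtain ⟨ρ, x, rfl⟩ := key ρ hρ
  obtain ⟨ν, y, rfl⟩ := key ν hν
  have hy : y = ν⁻¹ r := by
    rw [Equiv.Perm.eq_inv_iff_eq]
    simpa using h
  subst hy
  exact ⟨⟨ρ, ν, r, s, isCycleOn_insertAfter.1 hρ, isCycleOn_insertAfter.1 hν, by simpa using hrs⟩,
    x, rfl⟩

/-- If some ordinary edge reaches the non-root vertex through Region 4, then the secondary edge is
not the predecessor of the root edge there. -/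
theorem second_ne_of_numC_add_numD (D : BirootedDipole E) (h : D.numC + D.numD ≠ 0) :
    D.second ≠ D.rotNon⁻¹ D.root := by
  intro hs
  have key : ∀ y, D.IsOrdinary y → D.ThroughRegion3 y := by
    intro y hy
    refine lt_of_le_of_ne ?_ ((steps_injective D.rotNon_cycle D.root).ne hy.2)
    rw [hs]
    exact steps_le_steps_inv D.rotNon_cycle _ _
  refine h ?_
  rw [numC, numD, Nat.add_eq_zero_iff]
  exact ⟨Finite.card_eq_zero_iff.2 ⟨fun y => y.2.2.2 (key _ y.2.1)⟩,
    Finite.card_eq_zero_iff.2 ⟨fun y => y.2.2.2 (key _ y.2.1)⟩⟩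

end BirootedDipole

/-! ### Classes with a `c`- or `d`-edge as one-edge extensions -/

namespace Birooted

/-- The isomorphism class obtained from a dipole by insertion of an edge after the edge `p.2` of
the root vertex. -/
def extend (p : Σ c : Birooted, Fin c.1) : Birooted :=
  ⟨p.1.1 + 1, Quotient.mk (birootedSetoid _)
    ((p.1.2.out.insert p.2).transport (finSuccEquiv p.1.1).symm)⟩

/-- An isomorphism of extensions restricts to one of the original dipoles that matches the insertion
points. Once the classes agree, it is an automorphism of one representative, hence the identity. -/
theorem extend_injective : Function.Injective extend := by
  rintro ⟨⟨n, c⟩, x⟩ ⟨⟨n', c'⟩, x'⟩ h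
  obtain ⟨h1, h2⟩ := Sigma.mk.inj h
  simp only at x x'
  obtain rfl : n = n' := Nat.succ_injective h1
  obtain ⟨e⟩ := Quotient.exact (eq_of_heq h2)
  obtain ⟨e₀, he₀⟩ := DipoleIso.exists_of_insert (((BirootedDipole.transportIso _ _).trans e).trans
    (BirootedDipole.transportIso _ _).symm)
  simp only at e₀ he₀
  obtain rfl : c = c' := by
    rw [← Quotient.out_eq c, ← Quotient.out_eq c']
    exact Quotient.sound ⟨e₀⟩
  rw [e₀.toEquiv_apply_eq (DipoleIso.refl _)] at he₀
  rw [← he₀]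
  rfl

theorem exists_extend_eq {c : Birooted} (h : c.γ + c.δ ≠ 0) : ∃ p, extend p = c := by
  obtain ⟨m, q⟩ := c
  induction q using Quotient.inductionOn with
  | h D =>
  change D.numC + D.numD ≠ 0 at h
  cases m with
  | zero => exact D.root.elim0
  | succ n =>
    -- The edge to be deleted is renamed `none`.
    let π : Fin (n + 1) ≃ Option (Fin n) := finSuccEquiv' (D.rotNon⁻¹ D.root)
    have hπ : π (D.rotNon⁻¹ D.root) = none := finSuccEquiv'_at _
    have hn : ∀ y, y ≠ D.rotNon⁻¹ D.root → π y ≠ none := fun y hy h' =>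
      hy (π.injective (h'.trans hπ.symm))
    obtain ⟨D₀, x, hD⟩ := (D.transport π).exists_eq_insert
      (by rw [← hπ, ← (D.transportIso π).map_root]
          exact ((D.transportIso π).map_rotNon _).symm.trans (congrArg π (perm_apply_inv _ _)))
      (hn _ fun h' => D.rotNon_root_ne (by
        conv_lhs => rw [h', perm_apply_inv]))
      (hn _ (D.second_ne_of_numC_add_numD h))
    -- The chosen representative is only isomorphic to `D₀`, so the insertion point has to be
    -- carried along.
    let e : DipoleIso D₀ (Quotient.mk (birootedSetoid n) D₀).out :=
      (Quotient.exact (Quotient.out_eq (Quotient.mk (birootedSetoid n) D₀)).symm).some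
    refine ⟨⟨⟨n, Quotient.mk (birootedSetoid n) D₀⟩, e.toEquiv x⟩, ?_⟩
    refine congrArg (Sigma.mk (n + 1)) (Quotient.sound ⟨?_⟩)
    refine DipoleIso.trans (DipoleIso.trans (BirootedDipole.transportIso _ _).symm (e.insert x).symm) ?_
    rw [← hD]
    exact (D.transportIso π).symm

theorem finite_setOf_le (N : ℕ) : {c : Birooted | c.1 ≤ N}.Finite := by
  have h : ∀ n, Finite (BirootedDipole (Fin n)) := fun n =>
    Finite.of_injective (fun D => (D.rotRoot, D.rotNon, D.root, D.second)) fun D D' h => by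
      cases D
      cases D'
      simpa using h
  have h' : ∀ n, Finite (Quotient (birootedSetoid n)) := fun n => Quotient.finite _
  refine Set.Finite.subset (Set.finite_range
    fun p : Σ k : Fin (N + 1), Quotient (birootedSetoid k) => (⟨p.1, p.2⟩ : Birooted)) ?_
  rintro ⟨n, q⟩ hn
  exact ⟨⟨⟨n, Nat.lt_succ_of_le hn⟩, q⟩, rfl⟩

end Birooted

/-! ### Closed chains and decompositions into orbits -/

section Chain

variable {E : Type}

/-- The function `f` maps each entry of `a :: l` to the next one, and the last entry to `a`. -/
def ClosedChain (f : E → E) (a : E) (l : List E) : Prop :=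
  List.IsChain (fun u v => f u = v) (a :: (l ++ [a]))

/-- The orbit of a periodic point `x`, listed from `x` on. -/
def orbitList (f : E → E) (x : E) : List E :=
  (List.range (Function.minimalPeriod f x)).map fun i => f^[i] x

theorem getElem_of_isChain {f : E → E} {a : E} {l : List E}
    (h : List.IsChain (fun u v => f u = v) (a :: l)) (i : ℕ) (hi : i < (a :: l).length) :
    (a :: l)[i] = f^[i] a := by
  induction i with
  | zero => rfl
  | succ i ih =>
    rw [Function.iterate_succ_apply', ← ih (by omega)]
    exact (List.isChain_iff_getElem.1 h i (by simpa using hi)).symm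

/-- The entries are the iterates of `a`, and the length is a period. It is the minimal one, since a
smaller period would repeat `a` inside the list. -/
theorem orbitList_eq {f : E → E} {a : E} {l : List E} (h : ClosedChain f a l)
    (hn : (a :: l).Nodup) : orbitList f a = a :: l := by
  have h1 : ∀ i (hi : i < (a :: l).length), (a :: l)[i] = f^[i] a := fun i hi => by
    rw [← getElem_of_isChain h i (by simp at hi ⊢; omega)]
    exact (List.getElem_append_left (as := a :: l) (bs := [a]) hi).symm
  have h2 : Function.IsPeriodicPt f (l.length + 1) a := by
    have := getElem_of_isChain h (l.length + 1) (by simp)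
    rw [Function.IsPeriodicPt, Function.IsFixedPt, ← this]
    simp
  have h3 : Function.minimalPeriod f a = l.length + 1 := by
    refine le_antisymm (h2.minimalPeriod_le (Nat.succ_pos _)) ?_
    by_contra! h4
    have h5 := h1 (Function.minimalPeriod f a) (by simpa using h4)
    rw [Function.iterate_minimalPeriod] at h5
    have h6 : (a :: l)[Function.minimalPeriod f a]'(by simpa using h4) = (a :: l)[0] := h5
    have h7 := (hn.getElem_inj_iff).1 h6
    exact (h2.minimalPeriod_pos (Nat.succ_pos _)).ne' h7
  apply List.ext_getElem
  · simp [orbitList, h3]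
  · intro i hi hi'
    rw [h1 i hi']
    simp [orbitList]

theorem exists_orbitList_eq {f : E → E} {x : E} (hx : x ∈ Function.periodicPts f) :
    ∃ l, orbitList f x = x :: l ∧ ClosedChain f x l := by
  obtain ⟨m, hm⟩ := Nat.exists_eq_succ_of_ne_zero (Function.minimalPeriod_pos_of_mem_periodicPts hx).ne'
  refine ⟨(List.range m).map fun i => f^[i + 1] x, ?_, ?_⟩
  · rw [orbitList, hm, List.range_succ_eq_map, List.map_cons, List.map_map]
    rfl
  · have h : x :: ((List.range m).map (fun i => f^[i + 1] x) ++ [x]) =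
        (List.range (m + 2)).map fun i => f^[i] x := by
      have hx' : f^[m + 1] x = x := by
        have := Function.iterate_minimalPeriod (f := f) (x := x)
        rwa [hm] at this
      rw [List.range_succ_eq_map, List.map_cons, List.map_map, List.range_succ, List.map_append]
      simp only [Function.comp_def, List.map_cons, List.map_nil, Nat.succ_eq_add_one, hx']
      rfl
    rw [ClosedChain, h, List.isChain_iff_getElem]
    intro i hi
    simp only [List.getElem_map, List.getElem_range, Function.iterate_succ_apply']

theorem nodup_orbitList (f : E → E) (x : E) : (orbitList f x).Nodup :=
  Cycle.nodup_coe_iff.1 (Function.nodup_periodicOrbit (f := f) (x := x))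

/-- Cutting at `x` leaves a chain from `a` to `x` and a chain from `x` to `a`, which are reassembled
in the other order. -/
theorem ClosedChain.rotate {f : E → E} {a x : E} {l A B : List E} (h : ClosedChain f a l)
    (hl : a :: l = A ++ x :: B) : ClosedChain f x (B ++ A) := by
  cases A with
  | nil =>
    simp only [List.nil_append, List.cons.injEq] at hl
    obtain ⟨rfl, rfl⟩ := hl
    simpa using h
  | cons b A =>
    simp only [List.cons_append, List.cons.injEq] at hl
    obtain ⟨rfl, rfl⟩ := hl
    have h' : List.IsChain (fun u v => f u = v) ((a :: A) ++ x :: (B ++ [a])) := by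
      simpa [ClosedChain] using h
    rw [List.isChain_split] at h'
    have h'' : List.IsChain (fun u v => f u = v) ((x :: B) ++ a :: (A ++ [x])) :=
      List.isChain_split.2 ⟨by simpa using h'.2, by simpa using h'.1⟩
    simpa [ClosedChain] using h''

theorem mem_orbitList_iff [Finite E] (φ : Equiv.Perm E) (x y : E) :
    y ∈ orbitList φ x ↔ φ.SameCycle x y := by
  have hx : x ∈ Function.periodicPts φ := Function.Injective.mem_periodicPts φ.injective x
  have h : y ∈ orbitList φ x ↔ y ∈ Function.periodicOrbit φ x := Iff.rfl
  rw [h, Function.mem_periodicOrbit_iff hx]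
  simp only [Equiv.Perm.iterate_eq_pow]
  exact ⟨fun ⟨n, hn⟩ => ⟨n, by simpa using hn⟩, fun h => h.exists_nat_pow_eq⟩

/-- The lists of `𝓛` are the orbits of `f`, each of them listed once in cyclic order. -/
structure IsOrbitDecomp [Fintype E] (f : E → E) (𝓛 : Multiset (List E)) : Prop where
  chain : ∀ L ∈ 𝓛, ∃ a l, L = a :: l ∧ ClosedChain f a l
  cover : (𝓛.map fun L : List E => (L : Multiset E)).sum = Finset.univ.val

namespace IsOrbitDecomp

variable [Fintype E] {f : E → E} {𝓛 : Multiset (List E)}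

/-- As an equality of multisets, `cover` counts every point once, so it excludes repetitions within
a list and between lists. -/
theorem nodup (h : IsOrbitDecomp f 𝓛) {L : List E} (hL : L ∈ 𝓛) : L.Nodup := by
  classical
  have h1 := (Finset.univ : Finset E).nodup
  rw [← h.cover, ← Multiset.cons_erase hL, Multiset.map_cons, Multiset.sum_cons,
    Multiset.nodup_add] at h1
  exact h1.1

theorem cons_disjoint {L M : List E} (h : IsOrbitDecomp f (L ::ₘ 𝓛)) (hM : M ∈ 𝓛) {x : E}
    (hx : x ∈ L) : x ∉ M := by
  classical
  have h1 := (Finset.univ : Finset E).nodup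
  rw [← h.cover, ← Multiset.cons_erase hM, Multiset.map_cons, Multiset.sum_cons, Multiset.map_cons,
    Multiset.sum_cons, Multiset.nodup_add] at h1
  intro hx'
  exact Multiset.disjoint_left.1 h1.2.2 (Multiset.mem_coe.2 hx)
    (Multiset.mem_add.2 (Or.inl (Multiset.mem_coe.2 hx')))

/-- The starting point of one of the listed orbits can be changed. -/
theorem rotate {A B : List E} {x : E} (h : IsOrbitDecomp f ((A ++ x :: B) ::ₘ 𝓛)) :
    IsOrbitDecomp f ((x :: (B ++ A)) ::ₘ 𝓛) where
  chain L hL := by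
    obtain rfl | hL := Multiset.mem_cons.1 hL
    · obtain ⟨a, l, hl, hc⟩ := h.chain _ (Multiset.mem_cons_self _ _)
      exact ⟨_, _, rfl, hc.rotate hl.symm⟩
    · exact h.chain _ (Multiset.mem_cons_of_mem hL)
  cover := by
    rw [← h.cover, Multiset.map_cons, Multiset.map_cons, Multiset.sum_cons, Multiset.sum_cons]
    congr 1
    refine Multiset.coe_eq_coe.2 ?_
    rw [← List.cons_append]
    exact List.perm_append_comm

theorem exists_cons (φ : Equiv.Perm E) (r : E) :
    ∃ (t : List E) (𝓛 : Multiset (List E)), IsOrbitDecomp φ ((r :: t) ::ₘ 𝓛) := by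
  classical
  let Q := Quotient (Equiv.Perm.SameCycle.setoid φ)
  let mkQ : E → Q := Quotient.mk (Equiv.Perm.SameCycle.setoid φ)
  have : Fintype Q := Fintype.ofFinite _
  -- The update makes the cycle of `r` be listed from `r` itself.
  let rep : Q → E := Function.update Quotient.out (mkQ r) r
  have hrep : ∀ q, mkQ (rep q) = q := fun q => by
    by_cases hq : q = mkQ r
    · subst hq
      simp [rep]
    · simp only [rep, Function.update_of_ne hq]
      exact Quotient.out_eq q
  have hper : ∀ x, x ∈ Function.periodicPts φ := Function.Injective.mem_periodicPts φ.injective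
  have hdec : IsOrbitDecomp φ ((Finset.univ : Finset Q).val.map fun q => orbitList φ (rep q)) := by
    refine ⟨fun L hL => ?_, ?_⟩
    · obtain ⟨q, -, rfl⟩ := Multiset.mem_map.1 hL
      obtain ⟨l, hl, hc⟩ := exists_orbitList_eq (hper (rep q))
      exact ⟨_, l, hl, hc⟩
    · ext e
      rw [Multiset.map_map, Multiset.count_sum, Multiset.count_eq_one_of_mem Finset.univ.nodup
        (Finset.mem_univ e)]
      change ∑ q : Q, _ = 1
      rw [Finset.sum_eq_single (mkQ e)]
      · refine Multiset.count_eq_one_of_mem (nodup_orbitList _ _) ?_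
        refine (mem_orbitList_iff _ _ _).2 (Quotient.exact (s := Equiv.Perm.SameCycle.setoid φ) ?_)
        exact hrep (mkQ e)
      · intro q _ hq
        refine Multiset.count_eq_zero_of_notMem fun he => hq ?_
        rw [← hrep q]
        exact Quotient.sound ((mem_orbitList_iff _ _ _).1 he)
      · simp
  obtain ⟨t, ht, -⟩ := exists_orbitList_eq (hper r)
  have hmem : (r :: t) ∈ (Finset.univ : Finset Q).val.map fun q => orbitList φ (rep q) :=
    Multiset.mem_map.2 ⟨mkQ r, Finset.mem_univ _, by simp [rep, ht]⟩
  exact ⟨t, _, by rwa [Multiset.cons_erase hmem]⟩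

end IsOrbitDecomp

end Chain

/-! ### Faces and strings read off an orbit decomposition -/

namespace BirootedDipole

variable {E : Type} [Fintype E] (D : BirootedDipole E)

/-- The marks along an orbit of the face permutation. -/
def marks (L : List E) : List Bool := L.map D.mark

/-- Every edge occurs once in the lists, namely in the one whose head lies on its face; so the heads
represent each face once. All lists are nonempty, so the default of `headD` plays no role. -/
theorem faces_eq {t : List E} {𝓛 : Multiset (List E)}
    (h : IsOrbitDecomp D.faceStep ((D.root :: t) ::ₘ 𝓛)) [Fintype D.Face] :
    (Finset.univ : Finset D.Face).val =
      D.rootFace ::ₘ 𝓛.map fun L => D.faceAt (L.headD D.root) := by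
  classical
  have key : ∀ L ∈ (D.root :: t) ::ₘ 𝓛, ∀ e : E,
      Multiset.count e (L : Multiset E) = if D.faceAt e = D.faceAt (L.headD D.root) then 1 else 0 := by
    intro L hL e
    obtain ⟨a, l, rfl, hc⟩ := h.chain L hL
    have hmem : e ∈ a :: l ↔ D.faceAt e = D.faceAt a := by
      rw [← orbitList_eq hc (h.nodup hL), mem_orbitList_iff]
      exact ⟨fun h' => (Quotient.sound h').symm,
        fun h' => Quotient.exact (s := Equiv.Perm.SameCycle.setoid D.faceStep) h'.symm⟩
    rw [List.headD_cons]
    split_ifs with h'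
    · exact Multiset.count_eq_one_of_mem (h.nodup hL) (hmem.2 h')
    · exact Multiset.count_eq_zero_of_notMem fun h'' => h' (hmem.1 h'')
  have hcons : (D.rootFace ::ₘ 𝓛.map fun L => D.faceAt (L.headD D.root)) =
      ((D.root :: t) ::ₘ 𝓛).map fun L => D.faceAt (L.headD D.root) := by
    rw [Multiset.map_cons]
    rfl
  rw [hcons]
  ext F
  obtain ⟨e, rfl⟩ : ∃ e, D.faceAt e = F := ⟨F.out, Quotient.out_eq F⟩
  rw [Multiset.count_eq_one_of_mem Finset.univ.nodup (Finset.mem_univ _)]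
  have h1 := Multiset.count_eq_one_of_mem Finset.univ.nodup (Finset.mem_univ e)
  rw [← h.cover, Multiset.count_sum, Multiset.map_congr rfl fun L hL => key L hL e] at h1
  rw [Multiset.count_map, ← h1]
  generalize (D.root :: t) ::ₘ 𝓛 = s
  induction s using Multiset.induction_on with
  | empty => rfl
  | cons a s ih =>
    rw [Multiset.map_cons, Multiset.sum_cons, ih, Multiset.filter_cons]
    split_ifs <;> simp [add_comm]

theorem nat_card_face {t : List E} {𝓛 : Multiset (List E)}
    (h : IsOrbitDecomp D.faceStep ((D.root :: t) ::ₘ 𝓛)) :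
    Nat.card D.Face = Multiset.card 𝓛 + 1 := by
  have : Fintype D.Face := Fintype.ofFinite _
  rw [Nat.card_eq_fintype_card, ← Finset.card_univ, Finset.card_def, D.faces_eq h]
  simp

theorem rootString_eq {t : List E} {𝓛 : Multiset (List E)}
    (h : IsOrbitDecomp D.faceStep ((D.root :: t) ::ₘ 𝓛)) :
    D.rootString = D.marks (D.root :: t) := by
  obtain ⟨a, l, hl, hc⟩ := h.chain _ (Multiset.mem_cons_self _ _)
  obtain ⟨rfl, rfl⟩ := List.cons.inj hl
  rw [marks, ← orbitList_eq hc (h.nodup (Multiset.mem_cons_self _ _)), orbitList, List.map_map]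
  rfl

theorem nonrootStrings_eq {t : List E} {𝓛 : Multiset (List E)}
    (h : IsOrbitDecomp D.faceStep ((D.root :: t) ::ₘ 𝓛)) :
    D.nonrootStrings = 𝓛.map fun L => (D.marks L : Cycle Bool) := by
  classical
  let : Fintype {F : D.Face // F ≠ D.rootFace} := Fintype.ofFinite _
  have : Fintype D.Face := Fintype.ofFinite _
  have h1 : (Finset.univ : Finset {F : D.Face // F ≠ D.rootFace}).val.map Subtype.val =
      𝓛.map fun L => D.faceAt (L.headD D.root) := by
    have h2 := D.faces_eq h
    have h3 : (D.rootFace ::ₘ 𝓛.map fun L => D.faceAt (L.headD D.root)).Nodup := by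
      rw [← h2]
      exact Finset.univ.nodup
    rw [Multiset.nodup_cons] at h3
    refine (Multiset.Nodup.ext ?_ h3.2).2 fun F => ?_
    · exact Finset.univ.nodup.map Subtype.val_injective
    · have h4 : F ∈ (Finset.univ : Finset D.Face).val := Finset.mem_univ F
      rw [h2, Multiset.mem_cons] at h4
      constructor
      · intro hF
        obtain ⟨⟨F, hF'⟩, -, rfl⟩ := Multiset.mem_map.1 hF
        exact h4.resolve_left hF'
      · intro hF
        refine Multiset.mem_map.2 ⟨⟨F, ?_⟩, Finset.mem_univ _, rfl⟩
        rintro rfl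
        exact h3.1 hF
  have h5 : D.nonrootStrings =
      ((Finset.univ : Finset {F : D.Face // F ≠ D.rootFace}).val.map Subtype.val).map
        D.faceString := by
    rw [Multiset.map_map]
    rfl
  rw [h5, h1, Multiset.map_map]
  refine Multiset.map_congr rfl fun L hL => ?_
  obtain ⟨a, l, rfl, hc⟩ := h.chain L (Multiset.mem_cons_of_mem hL)
  change (((orbitList D.faceStep a).map fun x => D.mark x : List Bool) : Cycle Bool) = _
  rw [orbitList_eq hc (h.nodup (Multiset.mem_cons_of_mem hL))]
  rfl

end BirootedDipole

/-! ### The faces after the insertion of an edge -/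

section InsertChain

open Classical in
/-- The map `f'` on `Option E` arises from `f` by cutting the cycles of `f` before `x` and after `r`
and gluing them with the new point. -/
structure IsCutJoin {E : Type} (f : E → E) (r x : E) (f' : Option E → Option E) : Prop where
  apply_root : f' (some r) = some x
  apply_source : ∀ y, f' (if y = r then none else some y) = if f y = x then none else some (f y)

namespace IsCutJoin

variable {E : Type} {f : E → E} {r x : E} {f' : Option E → Option E}

open Classical in
-- Only the arrows out of `r` and into `x` are altered. A chain whose interior avoids both survives,
-- with a start `r` or an end `x` replaced by `none`.
theorem isChain (h : IsCutJoin f r x f') {a b : E} {A : List E}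
    (hA : List.IsChain (fun u v => f u = v) (a :: (A ++ [b]))) (hr : r ∉ A) (hx : x ∉ A) :
    List.IsChain (fun u v => f' u = v) ((if a = r then none else some a) ::
      (A.map some ++ [if b = x then none else some b])) := by
  induction A generalizing a with
  | nil =>
    simp only [List.nil_append, List.map_nil, List.isChain_cons_cons, List.isChain_singleton,
      and_true] at hA ⊢
    rw [h.apply_source, hA]
  | cons y A ih =>
    simp only [List.cons_append, List.isChain_cons_cons, List.map_cons, List.mem_cons, not_or]
      at hA hr hx ⊢
    have := ih hA.2 hr.2 hx.2
    rw [if_neg (Ne.symm hr.1)] at this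
    refine ⟨?_, this⟩
    rw [h.apply_source, hA.1, if_neg (Ne.symm hx.1)]

theorem closedChain_of_notMem (h : IsCutJoin f r x f') {a : E} {l : List E}
    (hl : ClosedChain f a l) (hr : r ∉ a :: l) (hx : x ∉ a :: l) :
    ClosedChain f' (some a) (l.map some) := by
  simp only [List.mem_cons, not_or] at hr hx
  have := h.isChain hl hr.2 hx.2
  rwa [if_neg (Ne.symm hr.1), if_neg (Ne.symm hx.1)] at this

/-- For `x = r` the root becomes a fixed point and `none` takes its place on the old cycle. -/
theorem closedChain_none_of_root (h : IsCutJoin f r r f') {t : List E} (ht : ClosedChain f r t)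
    (hr : r ∉ t) : ClosedChain f' none (t.map some) := by
  have := h.isChain ht hr hr
  rwa [if_pos rfl] at this

/-- The path from `r` to `x` closes up through `none`; the path from `x` back to `r` is closed by
the new arrow. -/
theorem closedChain_cut (h : IsCutJoin f r x f') {A B : List E}
    (ht : ClosedChain f r (A ++ x :: B)) (hn : (r :: (A ++ x :: B)).Nodup) :
    ClosedChain f' (some r) (some x :: B.map some) ∧ ClosedChain f' none (A.map some) := by
  have ht' : List.IsChain (fun u v => f u = v) ((r :: A) ++ x :: (B ++ [r])) := by
    simpa [ClosedChain] using ht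
  rw [List.isChain_split] at ht'
  simp only [List.nodup_cons, List.mem_append, List.mem_cons, not_or, List.nodup_append] at hn
  obtain ⟨⟨hrA, hrx, hrB⟩, -, ⟨hxB, -⟩, hAx⟩ := hn
  have hxA : x ∉ A := fun hx => hAx x hx x (Or.inl rfl) rfl
  have h1 := h.isChain ht'.2 hrB hxB
  have h2 := h.isChain (A := A) (b := x) (by simpa using ht'.1) hrA hxA
  rw [if_neg (Ne.symm hrx), if_neg hrx] at h1
  rw [if_pos rfl, if_pos rfl] at h2
  exact ⟨List.isChain_cons_cons.2 ⟨h.apply_root, h1⟩, h2⟩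

/-- The new arrow enters the cycle of `x`; after a full turn this reaches `none`, which continues
along the old path from `r`. -/
theorem closedChain_join (h : IsCutJoin f r x f') {t S : List E} (ht : ClosedChain f r t)
    (hS : ClosedChain f x S) (hrt : r ∉ t) (hxt : x ∉ r :: t) (hxS : x ∉ S) (hrS : r ∉ S) :
    ClosedChain f' (some r) (some x :: S.map some ++ none :: t.map some) := by
  simp only [List.mem_cons, not_or] at hxt
  have h1 := h.isChain ht hrt hxt.2
  have h2 := h.isChain hS hrS hxS
  rw [if_pos rfl, if_neg (Ne.symm hxt.1)] at h1
  rw [if_pos rfl, if_neg hxt.1] at h2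
  have h3 : List.IsChain (fun u v => f' u = v)
      ((some x :: S.map some) ++ none :: (t.map some ++ [some r])) :=
    List.isChain_split.2 ⟨h2, h1⟩
  have h4 : List.IsChain (fun u v => f' u = v)
      (some r :: some x :: (S.map some ++ none :: (t.map some ++ [some r]))) :=
    List.isChain_cons_cons.2 ⟨h.apply_root, h3⟩
  simpa [ClosedChain] using h4

variable {t : List E} {𝓛 : Multiset (List E)}

theorem exists_closedChain_map (h : IsCutJoin f r x f') (hc : ∀ L ∈ 𝓛, ∃ a l, L = a :: l ∧ ClosedChain f a l)
    (hr : ∀ L ∈ 𝓛, r ∉ L) (hx : ∀ L ∈ 𝓛, x ∉ L) :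
    ∀ L ∈ 𝓛.map (List.map some), ∃ a l, L = a :: l ∧ ClosedChain f' a l := by
  intro L hL
  obtain ⟨L, hL', rfl⟩ := Multiset.mem_map.1 hL
  obtain ⟨a, l, rfl, hal⟩ := hc L hL'
  exact ⟨some a, l.map some, rfl, h.closedChain_of_notMem hal (hr _ hL') (hx _ hL')⟩

variable [Fintype E]

theorem univ_option_val (s : List E) (h : ((s : Multiset E) + (𝓛.map fun L : List E => (L : Multiset E)).sum) =
    Finset.univ.val) :
    (Finset.univ : Finset (Option E)).val = none ::ₘ ((s.map some : List (Option E)) : Multiset (Option E)) +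
      ((𝓛.map (List.map some)).map fun L : List (Option E) => (L : Multiset (Option E))).sum := by
  have h1 : (Finset.univ : Finset (Option E)).val = none ::ₘ (Finset.univ : Finset E).val.map some :=
    rfl
  have h2 : ((𝓛.map (List.map some)).map fun L : List (Option E) => (L : Multiset (Option E))).sum =
      (𝓛.map fun L : List E => (L : Multiset E)).sum.map some := by
    rw [← Multiset.coe_mapAddMonoidHom some, map_multiset_sum, Multiset.map_map, Multiset.map_map]
    rfl
  rw [h1, ← h, h2, Multiset.map_add, Multiset.cons_add]
  rfl

theorem isOrbitDecomp_root (h : IsCutJoin f r r f') (hd : IsOrbitDecomp f ((r :: t) ::ₘ 𝓛)) :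
    IsOrbitDecomp f' ([some r] ::ₘ (none :: t.map some) ::ₘ 𝓛.map (List.map some)) where
  chain := by
    have hn := hd.nodup (Multiset.mem_cons_self _ _)
    obtain ⟨a, l, hl, hc⟩ := hd.chain _ (Multiset.mem_cons_self _ _)
    obtain ⟨rfl, rfl⟩ := List.cons.inj hl
    have hr : ∀ L ∈ 𝓛, r ∉ L := fun L hL => hd.cons_disjoint hL List.mem_cons_self
    simp only [Multiset.forall_mem_cons]
    refine ⟨⟨some r, [], rfl, ?_⟩, ⟨none, _, rfl, h.closedChain_none_of_root hc ?_⟩,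
      h.exists_closedChain_map (fun L hL => hd.chain L (Multiset.mem_cons_of_mem hL)) hr hr⟩
    · simpa [ClosedChain] using h.apply_root
    · exact (List.nodup_cons.1 hn).1
  cover := by
    have h1 := hd.cover
    rw [Multiset.map_cons, Multiset.sum_cons] at h1
    rw [univ_option_val _ h1, Multiset.map_cons, Multiset.sum_cons, Multiset.map_cons,
      Multiset.sum_cons, ← add_assoc]
    congr 1
    rw [Multiset.coe_add, Multiset.cons_coe, Multiset.coe_eq_coe]
    exact List.Perm.swap _ _ _

theorem isOrbitDecomp_cut (h : IsCutJoin f r x f') {A B : List E}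
    (hd : IsOrbitDecomp f ((r :: (A ++ x :: B)) ::ₘ 𝓛)) :
    IsOrbitDecomp f'
      ((some r :: some x :: B.map some) ::ₘ (none :: A.map some) ::ₘ 𝓛.map (List.map some)) where
  chain := by
    have hn := hd.nodup (Multiset.mem_cons_self _ _)
    obtain ⟨a, l, hl, hc⟩ := hd.chain _ (Multiset.mem_cons_self _ _)
    obtain ⟨rfl, rfl⟩ := List.cons.inj hl
    have hr : ∀ L ∈ 𝓛, r ∉ L := fun L hL => hd.cons_disjoint hL List.mem_cons_self
    have hx : ∀ L ∈ 𝓛, x ∉ L := fun L hL => hd.cons_disjoint hL (by simp)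
    simp only [Multiset.forall_mem_cons]
    exact ⟨⟨some r, _, rfl, (h.closedChain_cut hc hn).1⟩, ⟨none, _, rfl, (h.closedChain_cut hc hn).2⟩,
      h.exists_closedChain_map (fun L hL => hd.chain L (Multiset.mem_cons_of_mem hL)) hr hx⟩
  cover := by
    have h1 := hd.cover
    rw [Multiset.map_cons, Multiset.sum_cons] at h1
    rw [univ_option_val _ h1, Multiset.map_cons, Multiset.sum_cons, Multiset.map_cons,
      Multiset.sum_cons, ← add_assoc]
    congr 1
    rw [Multiset.coe_add, Multiset.cons_coe, Multiset.coe_eq_coe]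
    classical
    rw [List.perm_iff_count]
    intro e
    simp only [List.map_cons, List.map_append, List.count_cons, List.count_append, List.cons_append]
    omega

theorem isOrbitDecomp_join (h : IsCutJoin f r x f') {S : List E}
    (hd : IsOrbitDecomp f ((r :: t) ::ₘ (x :: S) ::ₘ 𝓛)) :
    IsOrbitDecomp f'
      ((some r :: (some x :: S.map some ++ none :: t.map some)) ::ₘ 𝓛.map (List.map some)) where
  chain := by
    have hmem : (x :: S) ∈ (r :: t) ::ₘ (x :: S) ::ₘ 𝓛 :=
      Multiset.mem_cons_of_mem (Multiset.mem_cons_self _ _)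
    have hn := List.nodup_cons.1 (hd.nodup (Multiset.mem_cons_self _ _))
    have hn' := List.nodup_cons.1 (hd.nodup hmem)
    obtain ⟨a, l, hl, hc⟩ := hd.chain _ (Multiset.mem_cons_self _ _)
    obtain ⟨rfl, rfl⟩ := List.cons.inj hl
    obtain ⟨a, l, hl, hc'⟩ := hd.chain _ hmem
    obtain ⟨rfl, rfl⟩ := List.cons.inj hl
    have hd' := hd
    rw [Multiset.cons_swap] at hd'
    have hr : ∀ L ∈ (x :: S) ::ₘ 𝓛, r ∉ L := fun L hL => hd.cons_disjoint hL List.mem_cons_self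
    have hx : ∀ L ∈ (r :: t) ::ₘ 𝓛, x ∉ L := fun L hL => hd'.cons_disjoint hL List.mem_cons_self
    rw [Multiset.forall_mem_cons] at hr hx ⊢
    exact ⟨⟨some r, _, rfl, h.closedChain_join hc hc' hn.1 hx.1 hn'.1
        fun h' => hr.1 (List.mem_cons_of_mem _ h')⟩,
      h.exists_closedChain_map (fun L hL => hd.chain L (Multiset.mem_cons_of_mem
        (Multiset.mem_cons_of_mem hL))) hr.2 hx.2⟩
  cover := by
    have h1 := hd.cover
    rw [Multiset.map_cons, Multiset.sum_cons, Multiset.map_cons, Multiset.sum_cons, ← add_assoc,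
      Multiset.coe_add] at h1
    rw [univ_option_val _ h1, Multiset.map_cons, Multiset.sum_cons]
    congr 1
    rw [Multiset.cons_coe, Multiset.coe_eq_coe]
    classical
    rw [List.perm_iff_count]
    intro e
    simp only [List.map_cons, List.map_append, List.count_cons, List.count_append, List.cons_append]
    omega

end IsCutJoin

end InsertChain

/-! ### Strings and genus after an insertion -/

namespace BirootedDipole

variable {E : Type} (D : BirootedDipole E)

theorem marks_cons (a : E) (l : List E) : D.marks (a :: l) = D.mark a :: D.marks l := rfl

theorem marks_append (l l' : List E) : D.marks (l ++ l') = D.marks l ++ D.marks l' := List.map_append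

variable [Fintype E]

/-- At the non-root vertex the walk along the root edge now turns to the new edge, whose clockwise
turn at the root vertex leads to `x`. The walk along the new edge makes the turn that the root edge
used to make. -/
theorem isCutJoin_insert (x : E) :
    IsCutJoin D.faceStep D.root x (D.insert x).faceStep where
  apply_root := by
    change (insertAfter _ _)⁻¹ ((insertAfter _ _)⁻¹ (some D.root)) = _
    conv_lhs =>
      enter [2, 2, 1]
      rw [← perm_apply_inv D.rotNon D.root]
    rw [insertAfter_inv_apply, insertAfter_inv_none]
  apply_source y := by
    classical
    change (insertAfter _ _)⁻¹ ((insertAfter _ _)⁻¹ _) = _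
    have h1 : (insertAfter D.rotNon (D.rotNon⁻¹ D.root))⁻¹
        (if y = D.root then none else some y) = some (D.rotNon⁻¹ y) := by
      split_ifs with hy
      · rw [insertAfter_inv_none, hy]
      · rw [insertAfter_inv_of_ne]
        rwa [perm_apply_inv]
    rw [h1]
    change _ = if D.rotRoot⁻¹ (D.rotNon⁻¹ y) = x then none else some (D.rotRoot⁻¹ (D.rotNon⁻¹ y))
    split_ifs with hx
    · rw [Equiv.Perm.inv_eq_iff_eq] at hx
      rw [hx, insertAfter_inv_apply]
    · rw [insertAfter_inv_of_ne]
      rintro h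
      rw [h, perm_inv_apply] at hx
      exact hx rfl

theorem marks_insert_map_some (x : E) (L : List E) : (D.insert x).marks (L.map some) = D.marks L := by
  rw [marks, marks, List.map_map]
  exact List.map_congr_left fun y _ => D.mark_insert_some x y

variable {t : List E} {𝓛 : Multiset (List E)}

theorem map_marks_insert (x : E) : ((𝓛.map (List.map some)).map fun L =>
      ((D.insert x).marks L : Cycle Bool)) = 𝓛.map fun L => (D.marks L : Cycle Bool) := by
  rw [Multiset.map_map]
  exact Multiset.map_congr rfl fun L _ => congrArg _ (D.marks_insert_map_some x L)

/-- This is the last summand of the cut coefficient. One more edge and one more face leave the genus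
unchanged. -/
theorem insert_root (hd : IsOrbitDecomp D.faceStep ((D.root :: t) ::ₘ 𝓛)) :
    (D.insert D.root).rootString = [D.mark D.root] ∧
    (D.insert D.root).nonrootStrings = (D.marks (D.root :: t) : Cycle Bool) ::ₘ D.nonrootStrings ∧
    (D.insert D.root).genus = D.genus := by
  have h := (D.isCutJoin_insert D.root).isOrbitDecomp_root hd
  refine ⟨?_, ?_, ?_⟩
  · rw [(D.insert D.root).rootString_eq h, ← D.mark_insert_some D.root]
    rfl
  · rw [(D.insert D.root).nonrootStrings_eq h, D.nonrootStrings_eq hd, Multiset.map_cons,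
      marks_cons, mark_insert_none, marks_insert_map_some, map_marks_insert]
    rfl
  · rw [genus, genus, (D.insert D.root).nat_card_face h, D.nat_card_face hd, Finite.card_option]
    simp

theorem insert_cut {A B : List E} {x : E}
    (hd : IsOrbitDecomp D.faceStep ((D.root :: (A ++ x :: B)) ::ₘ 𝓛)) :
    (D.insert x).rootString = D.mark D.root :: D.mark x :: D.marks B ∧
    (D.insert x).nonrootStrings = ((D.marks A ++ [D.mark x] : List Bool) : Cycle Bool) ::ₘ
      D.nonrootStrings ∧
    (D.insert x).genus = D.genus := by
  have h := (D.isCutJoin_insert x).isOrbitDecomp_cut hd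
  refine ⟨?_, ?_, ?_⟩
  · rw [(D.insert x).rootString_eq h, ← D.mark_insert_some x, ← D.mark_insert_some x,
      ← D.marks_insert_map_some x]
    rfl
  · rw [(D.insert x).nonrootStrings_eq h, D.nonrootStrings_eq hd, Multiset.map_cons,
      marks_cons, mark_insert_none, marks_insert_map_some, map_marks_insert]
    congr 1
    -- The new face is listed from `none`, so the mark of `x` comes first instead of last.
    exact Cycle.coe_eq_coe.2 ⟨1, by simp⟩
  · rw [genus, genus, (D.insert x).nat_card_face h, D.nat_card_face hd, Finite.card_option]
    simp

theorem insert_join {S : List E} {x : E}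
    (hd : IsOrbitDecomp D.faceStep ((D.root :: t) ::ₘ (x :: S) ::ₘ 𝓛)) :
    (D.insert x).rootString =
      D.mark D.root :: (D.mark x :: D.marks S ++ D.mark x :: D.marks t) ∧
    (D.insert x).nonrootStrings = 𝓛.map (fun L => (D.marks L : Cycle Bool)) ∧
    (D.insert x).genus = D.genus + 1 := by
  have h := (D.isCutJoin_insert x).isOrbitDecomp_join hd
  refine ⟨?_, ?_, ?_⟩
  · rw [(D.insert x).rootString_eq h, marks_cons, marks_append, marks_cons, marks_cons]
    simp only [marks_insert_map_some, mark_insert_none]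
    rw [← D.mark_insert_some x D.root, ← D.mark_insert_some x x]
    rfl
  · rw [(D.insert x).nonrootStrings_eq h, map_marks_insert]
  · have h1 : Nat.card D.Face ≤ Nat.card E :=
      Nat.card_le_card_of_surjective (D.faceAt) fun F => ⟨F.out, Quotient.out_eq F⟩
    rw [D.nat_card_face hd] at h1
    rw [genus, genus, (D.insert x).nat_card_face h, D.nat_card_face hd, Finite.card_option]
    rw [Multiset.card_map, Multiset.card_cons] at *
    omega

end BirootedDipole

/-! ### The differential operators on a single term -/

section Monomials

variable {K : Type*} [Field K]

theorem coeff_dIndet (i : Indet) (F : Series K) (e : Var →₀ ℕ) :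
    MvPowerSeries.coeff e (dIndet i F) = MvPolynomial.pderiv i (MvPowerSeries.coeff e F) := rfl

theorem coeff_dv (F : Series K) (e : Var →₀ ℕ) :
    MvPowerSeries.coeff e (dv F) =
      (e Var.v + 1) • MvPowerSeries.coeff (e + Finsupp.single Var.v 1) F := rfl

theorem dIndet_monomial (i : Indet) (m : Var →₀ ℕ) (p : MvPolynomial Indet K) :
    dIndet i (MvPowerSeries.monomial m p) = MvPowerSeries.monomial m (MvPolynomial.pderiv i p) := by
  classical
  ext1 e
  rw [coeff_dIndet, MvPowerSeries.coeff_monomial, MvPowerSeries.coeff_monomial]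
  split_ifs <;> simp

theorem dv_monomial (m : Var →₀ ℕ) (p : MvPolynomial Indet K) :
    dv (MvPowerSeries.monomial m p) =
      MvPowerSeries.monomial (m - Finsupp.single Var.v 1) (m Var.v • p) := by
  classical
  ext1 e
  rw [coeff_dv, MvPowerSeries.coeff_monomial, MvPowerSeries.coeff_monomial]
  by_cases h : e + Finsupp.single Var.v 1 = m
  · subst h
    simp
  · rw [if_neg h, smul_zero]
    split_ifs with h'
    -- Truncated subtraction can match here only when `m` has no `v`, and then the coefficient
    -- vanishes.
    · have h0 : m Var.v = 0 := by
        by_contra h0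
        refine h ?_
        rw [h', tsub_add_cancel_of_le]
        rw [Finsupp.single_le_iff]
        omega
      rw [h0, zero_smul]
    · rfl

/-- The product of the indeterminates `f_(S)` over a multiset of cyclic strings. -/
def fProd (K : Type*) [Field K] (Λ : Multiset (Cycle Bool)) : MvPolynomial Indet K :=
  (Λ.map fun S => MvPolynomial.X (Indet.f S)).prod

theorem prod_map_ff (Λ : Multiset (Cycle Bool)) :
    (Λ.map (ff K)).prod = MvPowerSeries.C (fProd K Λ) := by
  rw [fProd, map_multiset_prod, Multiset.map_map]
  rfl

theorem pderiv_g_fProd (S : List Bool) (Λ : Multiset (Cycle Bool)) :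
    MvPolynomial.pderiv (Indet.g S) (fProd K Λ) = 0 := by
  induction Λ using Multiset.induction_on with
  | empty => simp [fProd]
  | cons a s ih =>
    rw [fProd, Multiset.map_cons, Multiset.prod_cons, Derivation.leibniz,
      MvPolynomial.pderiv_X_of_ne (by simp)]
    rw [fProd] at ih
    simp [ih]

theorem pderiv_f_fProd (S : Cycle Bool) (Λ : Multiset (Cycle Bool)) :
    MvPolynomial.pderiv (Indet.f S) (fProd K Λ) = Λ.count S • fProd K (Λ.erase S) := by
  induction Λ using Multiset.induction_on with
  | empty => simp [fProd]
  | cons a s ih =>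
    have h : fProd K (a ::ₘ s) = MvPolynomial.X (Indet.f a) * fProd K s := by simp [fProd]
    rw [h, Derivation.leibniz, ih]
    by_cases ha : S = a
    · subst ha
      rw [MvPolynomial.pderiv_X_self, Multiset.count_cons_self, Multiset.erase_cons_head]
      by_cases hs : S ∈ s
      · have h' : fProd K s = MvPolynomial.X (Indet.f S) * fProd K (s.erase S) := by
          conv_lhs => rw [← Multiset.cons_erase hs]
          simp [fProd]
        rw [h', smul_eq_mul, smul_eq_mul, nsmul_eq_mul, nsmul_eq_mul]
        push_cast
        ring
      · simp [Multiset.count_eq_zero_of_notMem hs]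
    · rw [MvPolynomial.pderiv_X_of_ne (by simpa using Ne.symm ha), Multiset.count_cons_of_ne ha,
        Multiset.erase_cons_tail _ (Ne.symm ha)]
      simp only [fProd, Multiset.map_cons, Multiset.prod_cons, smul_eq_mul, nsmul_eq_mul]
      ring

theorem pderiv_g_monomial_coeff (k : K) (R R' : List Bool) (Λ : Multiset (Cycle Bool)) :
    MvPolynomial.pderiv (Indet.g R')
      (MvPolynomial.C k * (MvPolynomial.X (Indet.g R) * fProd K Λ)) =
      if R' = R then MvPolynomial.C k * fProd K Λ else 0 := by
  rw [Derivation.leibniz, Derivation.leibniz, pderiv_g_fProd, MvPolynomial.pderiv_C]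
  split_ifs with h
  · subst h
    simp [MvPolynomial.pderiv_X_self]
  · rw [MvPolynomial.pderiv_X_of_ne (by simpa using Ne.symm h)]
    simp

theorem pderiv_f_monomial_coeff (k : K) (R : List Bool) (S : Cycle Bool)
    (Λ : Multiset (Cycle Bool)) :
    MvPolynomial.pderiv (Indet.f S)
      (MvPolynomial.C k * (MvPolynomial.X (Indet.g R) * fProd K Λ)) =
      Λ.count S • (MvPolynomial.C k * (MvPolynomial.X (Indet.g R) * fProd K (Λ.erase S))) := by
  rw [Derivation.leibniz, Derivation.leibniz, pderiv_f_fProd, MvPolynomial.pderiv_C,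
    MvPolynomial.pderiv_X_of_ne (by simp)]
  simp only [smul_eq_mul, nsmul_eq_mul]
  ring

theorem cutOp_monomial (m : Var →₀ ℕ) (k : K) (R : List Bool) (Λ : Multiset (Cycle Bool)) :
    cutOp (MvPowerSeries.monomial m (MvPolynomial.C k * (MvPolynomial.X (Indet.g R) * fProd K Λ))) =
      MvPowerSeries.monomial m (MvPolynomial.C k) * (cutCoeff K R * (Λ.map (ff K)).prod) := by
  ext1 e
  change ∑ᶠ R', _ = _
  rw [finsum_eq_single _ R]
  · rw [dIndet_monomial, pderiv_g_monomial_coeff, if_pos rfl, prod_map_ff, mul_left_comm,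
      ← MvPowerSeries.monomial_zero_eq_C_apply, MvPowerSeries.monomial_mul_monomial, add_zero]
  · intro R' h
    rw [dIndet_monomial, pderiv_g_monomial_coeff, if_neg h, map_zero, mul_zero, map_zero]

/-- `∂/∂f_(S)` produces the multiplicity of `S` in `Λ`, so the sum over cyclic strings becomes a sum
over `Λ`, with one summand per occurrence. -/
theorem joinOp_monomial (m : Var →₀ ℕ) (k : K) (R : List Bool) (Λ : Multiset (Cycle Bool)) :
    joinOp (MvPowerSeries.monomial m (MvPolynomial.C k * (MvPolynomial.X (Indet.g R) * fProd K Λ))) =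
      MvPowerSeries.monomial m (MvPolynomial.C k) *
        (Λ.map fun S => joinCoeff K R S * ((Λ.erase S).map (ff K)).prod).sum := by
  have key : ∀ p : List Bool × Cycle Bool, dIndet (.g p.1) (dIndet (.f p.2)
      (MvPowerSeries.monomial m (MvPolynomial.C k * (MvPolynomial.X (Indet.g R) * fProd K Λ)))) =
      if p.1 = R then MvPowerSeries.monomial m (MvPolynomial.C k) *
        (Λ.count p.2 • ((Λ.erase p.2).map (ff K)).prod) else 0 := by
    intro p
    rw [dIndet_monomial, dIndet_monomial, pderiv_f_monomial_coeff, map_nsmul,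
      pderiv_g_monomial_coeff]
    split_ifs
    · rw [prod_map_ff, mul_smul_comm, ← MvPowerSeries.monomial_zero_eq_C_apply,
        MvPowerSeries.monomial_mul_monomial, add_zero, map_nsmul]
    · simp
  ext1 e
  change ∑ᶠ p : List Bool × Cycle Bool, _ = _
  simp only [key]
  have hsum : MvPowerSeries.monomial m (MvPolynomial.C k) *
        (Λ.map fun S => joinCoeff K R S * ((Λ.erase S).map (ff K)).prod).sum =
      ∑ S ∈ Λ.toFinset, joinCoeff K R S * (MvPowerSeries.monomial m (MvPolynomial.C k) *
        (Λ.count S • ((Λ.erase S).map (ff K)).prod)) := by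
    rw [Finset.sum_multiset_map_count, Finset.mul_sum]
    refine Finset.sum_congr rfl fun S _ => ?_
    simp only [nsmul_eq_mul]
    ring
  rw [finsum_eq_sum_of_support_subset (s := {R} ×ˢ Λ.toFinset), hsum]
  · rw [Finset.sum_product, Finset.sum_singleton, map_sum]
    simp only [if_true]
  · rintro ⟨R', S⟩ h
    rw [Function.mem_support] at h
    simp only [Finset.coe_product, Finset.coe_singleton, Set.mem_prod, Set.mem_singleton_iff,
      Finset.mem_coe, Multiset.mem_toFinset]
    constructor
    · by_contra h'
      simp [h'] at h
    · by_contra h'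
      simp [Multiset.count_eq_zero_of_notMem h'] at h

end Monomials

/-! ### The terms of the dipole series -/

section Terms

variable (K : Type*) [Field K]

/-- The exponent of the term of `c` in the `(a,b,c,d)`-dipole series. -/
def gammaExp (c : Birooted) : Var →₀ ℕ :=
  Finsupp.single Var.x (c.α + 1) + Finsupp.single Var.y c.β + Finsupp.single Var.v (c.γ + c.δ) +
    Finsupp.single Var.w c.δ + Finsupp.single Var.u (2 * c.genus)

/-- The scalar factor of the term of `c` in the `(a,b,c,d)`-dipole series. -/
def gammaCst (c : Birooted) : K :=
  (((c.α + 1).factorial : ℕ) : K)⁻¹ * ((c.β.factorial : ℕ) : K)⁻¹ *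
    (((c.γ + c.δ).factorial : ℕ) : K)⁻¹

/-- The factor of the term of `c` that contains no `g_S` or `f_(S)`. -/
def gammaWeight (c : Birooted) : Series K :=
  MvPowerSeries.monomial (gammaExp c) (MvPolynomial.C (gammaCst K c))

theorem gammaTerm_eq_mul (c : Birooted) :
    gammaTerm K c = gammaWeight K c * (gg K c.R * (c.Λ.map (ff K)).prod) := by
  have h : gammaWeight K c = invNat K (c.α + 1).factorial * var K .x ^ (c.α + 1) *
    (invNat K c.β.factorial * var K .y ^ c.β) *
    (invNat K (c.γ + c.δ).factorial * var K .v ^ (c.γ + c.δ)) *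
    var K .w ^ c.δ * var K .u ^ (2 * c.genus) := by
    simp only [gammaWeight, gammaExp, gammaCst, invNat, var, MvPowerSeries.X_pow_eq,
      ← MvPowerSeries.monomial_zero_eq_C_apply, MvPowerSeries.monomial_mul_monomial, zero_add,
      mul_one, map_mul]
  rw [h, gammaTerm]
  ring

theorem gammaTerm_eq_monomial (c : Birooted) :
    gammaTerm K c = MvPowerSeries.monomial (gammaExp c)
      (MvPolynomial.C (gammaCst K c) * (MvPolynomial.X (Indet.g c.R) * fProd K c.Λ)) := by
  rw [gammaTerm_eq_mul, prod_map_ff, gg, gammaWeight, ← map_mul,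
    ← MvPowerSeries.monomial_zero_eq_C_apply, MvPowerSeries.monomial_mul_monomial, add_zero]

theorem cutOp_gammaTerm (c : Birooted) :
    cutOp (gammaTerm K c) = gammaWeight K c * (cutCoeff K c.R * (c.Λ.map (ff K)).prod) := by
  rw [gammaTerm_eq_monomial, cutOp_monomial, gammaWeight]

theorem joinOp_gammaTerm (c : Birooted) :
    joinOp (gammaTerm K c) = gammaWeight K c *
      (c.Λ.map fun S => joinCoeff K c.R S * ((c.Λ.erase S).map (ff K)).prod).sum := by
  rw [gammaTerm_eq_monomial, joinOp_monomial, gammaWeight]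

theorem gammaExp_v (c : Birooted) : gammaExp c Var.v = c.γ + c.δ := by
  simp [gammaExp]

theorem dv_gammaTerm_of_eq_zero {c : Birooted} (h : c.γ + c.δ = 0) : dv (gammaTerm K c) = 0 := by
  rw [gammaTerm_eq_monomial, dv_monomial, gammaExp_v, h, zero_smul, map_zero]

/-- The factor `m + 1` produced by the derivative turns `1 / (m + 1)!` into `1 / m!`, where `m = c.γ
+ c.δ`. What remains is the weight of `c` times the change in `w` and `u`. -/
theorem dv_gammaTerm [CharZero K] {c c' : Birooted} {s : Bool} {j : ℕ} (hα : c'.α = c.α)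
    (hβ : c'.β = c.β) (hγ : c'.γ = c.γ + if s = true then 0 else 1)
    (hδ : c'.δ = c.δ + if s = true then 1 else 0) (hg : c'.genus = c.genus + j) :
    dv (gammaTerm K c') = gammaWeight K c * (wpow K s * (var K .u ^ 2) ^ j *
      (gg K c'.R * (c'.Λ.map (ff K)).prod)) := by
  have hv : c'.γ + c'.δ = c.γ + c.δ + 1 := by
    rw [hγ, hδ]
    split_ifs <;> omega
  have hw : wpow K s = MvPowerSeries.monomial (Finsupp.single Var.w (if s = true then 1 else 0)) 1 := by
    cases s
    · simp [wpow]
    · simp [wpow, var, MvPowerSeries.X]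
  have hu : (var K .u ^ 2) ^ j = MvPowerSeries.monomial (Finsupp.single Var.u (2 * j)) 1 := by
    rw [← pow_mul, var, MvPowerSeries.X_pow_eq]
  have hexp : gammaExp c' - Finsupp.single Var.v 1 =
      gammaExp c + (Finsupp.single Var.w (if s = true then 1 else 0) +
        Finsupp.single Var.u (2 * j)) := by
    ext i
    simp only [gammaExp, hα, hβ, hv, hg, Finsupp.coe_tsub, Finsupp.coe_add, Pi.sub_apply,
      Pi.add_apply]
    cases i <;> simp [mul_add, hδ]
  have hc : gammaCst K c' * ((c'.γ + c'.δ : ℕ) : K) = gammaCst K c := by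
    rw [gammaCst, gammaCst, hα, hβ, hv, Nat.factorial_succ (c.γ + c.δ), Nat.cast_mul, mul_inv]
    have : ((c.γ + c.δ + 1 : ℕ) : K) ≠ 0 := Nat.cast_ne_zero.2 (Nat.succ_ne_zero _)
    field_simp
  have hgf : gg K c'.R * MvPowerSeries.C (fProd K c'.Λ) =
      MvPowerSeries.monomial 0 (MvPolynomial.X (Indet.g c'.R) * fProd K c'.Λ) := by
    rw [gg, ← map_mul, MvPowerSeries.monomial_zero_eq_C_apply]
  rw [gammaTerm_eq_monomial, dv_monomial, hexp, gammaExp_v, hw, hu, prod_map_ff, hgf, gammaWeight,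
    MvPowerSeries.monomial_mul_monomial, MvPowerSeries.monomial_mul_monomial,
    MvPowerSeries.monomial_mul_monomial, add_zero, one_mul, one_mul, ← hc, map_mul MvPolynomial.C, nsmul_eq_mul,
    map_natCast, mul_left_comm, mul_assoc]

end Terms

/-! ### The sum over all insertions -/

section Insertions

variable {K : Type*} [Field K]

namespace Birooted

theorem mk_out (c : Birooted) : (⟨c.1, Quotient.mk _ c.2.out⟩ : Birooted) = c := by
  obtain ⟨n, q⟩ := c
  exact congrArg (Sigma.mk n) (Quotient.out_eq q)

theorem dv_gammaTerm_extend [CharZero K] (c : Birooted) (x : Fin c.1) {j : ℕ} {R : List Bool}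
    {Λ : Multiset (Cycle Bool)} (h : (c.2.out.insert x).rootString = R ∧
      (c.2.out.insert x).nonrootStrings = Λ ∧ (c.2.out.insert x).genus = c.2.out.genus + j) :
    dv (gammaTerm K (extend ⟨c, x⟩)) = gammaWeight K c *
      (wpow K (c.2.out.mark x) * (var K .u ^ 2) ^ j * (gg K R * (Λ.map (ff K)).prod)) := by
  obtain ⟨rfl, rfl, hg⟩ := h
  have e := (c.2.out.insert x).transportIso (finSuccEquiv c.1).symm
  have hR : (extend ⟨c, x⟩).R = (c.2.out.insert x).rootString := e.rootString_eq.symm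
  have hΛ : (extend ⟨c, x⟩).Λ = (c.2.out.insert x).nonrootStrings := e.nonrootStrings_eq.symm
  rw [dv_gammaTerm K (c := c) (s := c.2.out.mark x) (j := j), hR, hΛ]
  · exact e.numA_eq.symm.trans ((c.2.out.numA_insert x).trans (congrArg α (mk_out c)))
  · exact e.numB_eq.symm.trans ((c.2.out.numB_insert x).trans (congrArg β (mk_out c)))
  · exact e.numC_eq.symm.trans ((c.2.out.numC_insert x).trans
      (congrArg (fun c : Birooted => c.γ + _) (mk_out c)))
  · exact e.numD_eq.symm.trans ((c.2.out.numD_insert x).trans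
      (congrArg (fun c : Birooted => c.δ + _) (mk_out c)))
  · exact e.genus_eq.symm.trans (hg.trans
      (congrArg (fun c : Birooted => c.genus + j) (mk_out c)))

end Birooted

/-- Cyclic shifts are indexed by positions, hence by the edges along a face; symmetric strings keep
their multiplicity. -/
theorem joinCoeff_coe (R m : List Bool) (hm : m ≠ []) :
    joinCoeff K R (m : Cycle Bool) = ∑ i : Fin m.length, joinTerm K R (m.rotate i) := by
  have h : m.cyclicPermutations = (List.finRange m.length).map fun i : Fin m.length => m.rotate i := by
    apply List.ext_getElem
    · simp [List.length_cyclicPermutations_of_ne_nil _ hm]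
    · intro i h1 h2
      simp
  rw [joinCoeff, Cycle.lists_coe, Multiset.map_coe, Multiset.sum_coe, h, List.map_map,
    Fin.sum_univ_def]
  rfl

theorem sum_map_sum_coe {E M : Type*} [AddCommMonoid M] (𝓛 : Multiset (List E)) (h : E → M) :
    ((𝓛.map fun L : List E => (L : Multiset E)).sum.map h).sum =
      (𝓛.map fun L => (L.map h).sum).sum := by
  induction 𝓛 using Multiset.induction_on with
  | empty => rfl
  | cons L 𝓛 ih =>
    simp only [Multiset.map_cons, Multiset.sum_cons, Multiset.map_add, Multiset.sum_add, ih,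
      Multiset.map_coe, Multiset.sum_coe]

/-- The root corner is always black, which is why the last summand of the cut coefficient carries
`w` unconditionally. -/
theorem BirootedDipole.mark_root {E : Type} [Finite E] (D : BirootedDipole E) :
    D.mark D.root = true := by
  rw [mark_eq_true_iff, ThroughRegion1, steps_self, Nat.pos_iff_ne_zero]
  intro h
  rw [← steps_self D.rotRoot D.root] at h
  exact D.root_ne_second (steps_injective D.rotRoot_cycle D.root h).symm

/-- The corners are grouped by face: the root corner and the others on the root face give the cut
operator, and each further face gives one summand of the join operator. -/
theorem sum_dv_gammaTerm_extend [CharZero K] (c : Birooted) :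
    ∑ x : Fin c.1, dv (gammaTerm K (Birooted.extend ⟨c, x⟩)) =
      cutOp (gammaTerm K c) + var K .u ^ 2 * joinOp (gammaTerm K c) := by
  set D := c.2.out with hD
  set h : Fin c.1 → Series K := fun x => dv (gammaTerm K (Birooted.extend ⟨c, x⟩)) with hh
  obtain ⟨t, 𝓛, hd⟩ := IsOrbitDecomp.exists_cons D.faceStep D.root
  have hR : c.R = D.mark D.root :: D.marks t :=
    (congrArg Birooted.R c.mk_out).symm.trans (D.rootString_eq hd)
  have hΛ' : D.nonrootStrings = c.Λ := congrArg Birooted.Λ c.mk_out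
  have hΛ : c.Λ = 𝓛.map fun L => (D.marks L : Cycle Bool) := hΛ'.symm.trans (D.nonrootStrings_eq hd)
  have hsum : ∑ x, h x = h D.root + (t.map h).sum + (𝓛.map fun L => (L.map h).sum).sum := by
    change ((Finset.univ : Finset (Fin c.1)).val.map h).sum = _
    rw [← hd.cover, sum_map_sum_coe, Multiset.map_cons, Multiset.sum_cons, List.map_cons,
      List.sum_cons]
  have hroot : h D.root = gammaWeight K c * (var K .w * gg K [D.mark D.root] * ff K (c.R : Cycle Bool) *
      (c.Λ.map (ff K)).prod) := by
    rw [hh]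
    dsimp only
    rw [c.dv_gammaTerm_extend D.root (j := 0) (D.insert_root hd), hΛ', Multiset.map_cons,
      Multiset.prod_cons, ← hD, D.mark_root, hR]
    simp only [wpow, BirootedDipole.marks_cons, D.mark_root, if_true]
    ring
  have htail : (t.map h).sum = gammaWeight K c * ((∑ j : Fin (D.marks t).length,
      wpow K ((D.marks t).get j) * gg K (D.mark D.root :: (D.marks t).drop (j : ℕ)) *
        ff K ((D.marks t).take ((j : ℕ) + 1) : List Bool)) * (c.Λ.map (ff K)).prod) := by
    rw [← Fin.sum_univ_fun_getElem, Finset.sum_mul, Finset.mul_sum]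
    refine Fintype.sum_equiv (finCongr (by simp [BirootedDipole.marks])) _ _ fun j => ?_
    have ht : t = t.take j ++ t[(j : ℕ)] :: t.drop (j + 1) := by simp
    have hd' := hd
    rw [ht] at hd'
    have h1 : D.marks t = D.marks (t.take j) ++ D.mark t[(j : ℕ)] :: D.marks (t.drop (j + 1)) := by
      rw [← BirootedDipole.marks_cons, ← BirootedDipole.marks_append, ← ht]
    have h2 : (D.marks (t.take j)).length = j := by
      simp [BirootedDipole.marks]
    rw [hh]
    dsimp only
    rw [c.dv_gammaTerm_extend t[(j : ℕ)] (j := 0) (D.insert_cut hd'), hΛ', Multiset.map_cons, Multiset.prod_cons]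
    have h3 : (D.marks t).get (finCongr (by simp [BirootedDipole.marks]) j) = D.mark t[(j : ℕ)] := by
      simp only [BirootedDipole.marks, List.get_eq_getElem, List.getElem_map]
      rfl
    have h4 : (D.marks t).drop j = D.mark t[(j : ℕ)] :: D.marks (t.drop (j + 1)) := by
      rw [h1, List.drop_left' h2]
    have h5 : (D.marks t).take (j + 1) = D.marks (t.take j) ++ [D.mark t[(j : ℕ)]] := by
      rw [h1, List.take_append, List.take_of_length_le (by omega), h2]
      simp
    rw [h3, finCongr_apply_coe, h4, h5]
    ring
  have hface : ∀ L ∈ 𝓛, (L.map h).sum = gammaWeight K c * (var K .u ^ 2 *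
      (joinCoeff K c.R (D.marks L : Cycle Bool) *
        ((c.Λ.erase (D.marks L : Cycle Bool)).map (ff K)).prod)) := by
    intro L hL
    obtain ⟨𝓜, rfl⟩ := Multiset.exists_cons_of_mem hL
    have hne : D.marks L ≠ [] := by
      obtain ⟨a, l, rfl, -⟩ := hd.chain L (Multiset.mem_cons_of_mem hL)
      simp [BirootedDipole.marks]
    rw [hΛ, Multiset.map_cons, Multiset.erase_cons_head, joinCoeff_coe _ _ hne,
      ← Fin.sum_univ_fun_getElem, Finset.sum_mul, Finset.mul_sum, Finset.mul_sum]
    refine Fintype.sum_equiv (finCongr (by simp [BirootedDipole.marks])) _ _ fun j => ?_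
    have hj : L = L.take j ++ L[(j : ℕ)] :: L.drop (j + 1) := by simp
    have hd' := hd
    rw [hj, Multiset.cons_swap] at hd'
    -- The face is relisted from the insertion point, which produces the cyclic shift of its string.
    replace hd' := hd'.rotate
    rw [Multiset.cons_swap] at hd'
    rw [hh]
    dsimp only
    rw [c.dv_gammaTerm_extend L[(j : ℕ)] (j := 1) (D.insert_join hd')]
    have h3 : (D.marks L).rotate (finCongr (by simp [BirootedDipole.marks] :
        L.length = (D.marks L).length) j : Fin (D.marks L).length) =
        D.mark L[(j : ℕ)] :: D.marks (L.drop (j + 1) ++ L.take j) := by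
      rw [finCongr_apply_coe, BirootedDipole.marks, ← List.map_rotate,
        List.rotate_eq_drop_append_take j.2.le, List.drop_eq_getElem_cons j.2]
      rfl
    rw [h3, hR]
    simp only [joinTerm, pow_one, List.cons_append, ← hD]
    ring
  rw [hsum, hroot, htail, Multiset.map_congr rfl hface, cutOp_gammaTerm, joinOp_gammaTerm,
    Multiset.sum_map_mul_left, Multiset.sum_map_mul_left]
  have hcut : cutCoeff K c.R = (∑ j : Fin (D.marks t).length,
      wpow K ((D.marks t).get j) * gg K (D.mark D.root :: (D.marks t).drop (j : ℕ)) *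
        ff K ((D.marks t).take ((j : ℕ) + 1) : List Bool)) +
      var K .w * gg K [D.mark D.root] * ff K (c.R : Cycle Bool) := by
    rw [hR]
    rfl
  have hmap : (c.Λ.map fun S => joinCoeff K c.R S * ((c.Λ.erase S).map (ff K)).prod) =
      𝓛.map fun L => joinCoeff K c.R (D.marks L : Cycle Bool) *
        ((c.Λ.erase (D.marks L : Cycle Bool)).map (ff K)).prod := by
    conv_lhs =>
      arg 2
      rw [hΛ]
    rw [Multiset.map_map]
    rfl
  rw [hcut, hmap]
  ring

end Insertions

/-! ### Truncation to finitely many dipoles -/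

theorem BirootedDipole.card_edge {E : Type} [Finite E] (D : BirootedDipole E) :
    Nat.card E = D.numA + D.numB + D.numC + D.numD + 2 := by
  classical
  have := Fintype.ofFinite E
  have h : ∀ y : E, 1 =
      (if D.IsOrdinary y ∧ ¬ D.ThroughRegion1 y ∧ D.ThroughRegion3 y then 1 else 0) +
      (if D.IsOrdinary y ∧ D.ThroughRegion1 y ∧ D.ThroughRegion3 y then 1 else 0) +
      (if D.IsOrdinary y ∧ ¬ D.ThroughRegion1 y ∧ ¬ D.ThroughRegion3 y then 1 else 0) +
      (if D.IsOrdinary y ∧ D.ThroughRegion1 y ∧ ¬ D.ThroughRegion3 y then 1 else 0) +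
      (if y = D.root then 1 else 0) + (if y = D.second then 1 else 0) := by
    intro y
    by_cases hr : y = D.root
    · simp [IsOrdinary, hr, D.root_ne_second]
    · by_cases hs : y = D.second
      · simp [IsOrdinary, hs, D.root_ne_second.symm]
      · by_cases h1 : D.ThroughRegion1 y <;> by_cases h3 : D.ThroughRegion3 y <;>
          simp [IsOrdinary, hr, hs, h1, h3]
  rw [Nat.card_eq_fintype_card, Fintype.card_eq_sum_ones, Finset.sum_congr rfl fun y _ => h y]
  simp only [Finset.sum_add_distrib, ← Finset.card_filter, numA, numB, numC, numD,
    Nat.card_eq_fintype_card, Fintype.card_subtype]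
  simp only [add_assoc, Nat.add_left_cancel_iff]
  exact congrArg₂ (· + ·) (Finset.card_eq_one.2 ⟨D.root, by ext; simp⟩)
    (Finset.card_eq_one.2 ⟨D.second, by ext; simp⟩)

theorem Birooted.fst_eq (c : Birooted) : c.1 = c.α + c.β + c.γ + c.δ + 2 := by
  obtain ⟨n, q⟩ := c
  induction q using Quotient.inductionOn with
  | h D =>
    have := D.card_edge
    rw [Nat.card_fin] at this
    exact this

/-- The dipoles with at most `N` edges. -/
def dipolesUpTo (N : ℕ) : Finset Birooted := (Birooted.finite_setOf_le N).toFinset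

theorem mem_dipolesUpTo {N : ℕ} {c : Birooted} : c ∈ dipolesUpTo N ↔ c.1 ≤ N := by
  simp [dipolesUpTo]

variable {K : Type*} [Field K]

theorem coeff_gammaTerm_of_ne {c : Birooted} {e : Var →₀ ℕ} (h : e ≠ gammaExp c) :
    MvPowerSeries.coeff e (gammaTerm K c) = 0 := by
  classical
  rw [gammaTerm_eq_monomial, MvPowerSeries.coeff_monomial, if_neg h]

/-- A term with exponent `e` comes from a dipole with `e x + e y + e v + 1` edges: the exponent of
`x` is `α + 1`, and there are two non-ordinary edges. -/
theorem coeff_Gam {e : Var →₀ ℕ} {N : ℕ} (hN : e Var.x + e Var.y + e Var.v + 1 ≤ N) :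
    MvPowerSeries.coeff e (Gam K) =
      MvPowerSeries.coeff e (∑ c ∈ dipolesUpTo N, gammaTerm K c) := by
  rw [map_sum]
  refine finsum_eq_sum_of_support_subset _ fun c hc => ?_
  have he : e = gammaExp c := by
    by_contra he
    exact hc (coeff_gammaTerm_of_ne he)
  rw [Finset.mem_coe, mem_dipolesUpTo, c.fst_eq]
  subst he
  simp [gammaExp] at hN
  omega

theorem dIndet_sum {ι : Type*} (i : Indet) (s : Finset ι) (F : ι → Series K) :
    dIndet i (∑ c ∈ s, F c) = ∑ c ∈ s, dIndet i (F c) := by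
  ext1 e
  simp only [coeff_dIndet, map_sum]

theorem dIndet_g_gammaTerm {c : Birooted} {R : List Bool} (h : R ≠ c.R) :
    dIndet (.g R) (gammaTerm K c) = 0 := by
  rw [gammaTerm_eq_monomial, dIndet_monomial, pderiv_g_monomial_coeff, if_neg h, map_zero]

theorem dIndet_g_dIndet_f_gammaTerm {c : Birooted} {R : List Bool} {S : Cycle Bool}
    (h : R ≠ c.R ∨ S ∉ c.Λ) : dIndet (.g R) (dIndet (.f S) (gammaTerm K c)) = 0 := by
  rw [gammaTerm_eq_monomial, dIndet_monomial, dIndet_monomial, pderiv_f_monomial_coeff, map_nsmul,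
    pderiv_g_monomial_coeff]
  obtain h | h := h
  · rw [if_neg h, smul_zero, map_zero]
  · rw [Multiset.count_eq_zero_of_notMem h, zero_smul, map_zero]

/-- Additivity of `finsum` needs finite supports; here each term is seen only by the derivative for
its own root string. -/
theorem cutOp_sum_gammaTerm (T : Finset Birooted) :
    cutOp (∑ c ∈ T, gammaTerm K c) = ∑ c ∈ T, cutOp (gammaTerm K c) := by
  ext1 e
  rw [map_sum]
  change ∑ᶠ R, _ = ∑ c ∈ T, ∑ᶠ R, _
  simp only [dIndet_sum, Finset.mul_sum, map_sum]
  refine finsum_sum_comm T _ fun c _ => ?_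
  refine (Set.finite_singleton c.R).subset fun R hR => ?_
  by_contra h
  refine hR ?_
  dsimp only
  rw [dIndet_g_gammaTerm h, mul_zero, map_zero]

theorem joinOp_sum_gammaTerm (T : Finset Birooted) :
    joinOp (∑ c ∈ T, gammaTerm K c) = ∑ c ∈ T, joinOp (gammaTerm K c) := by
  ext1 e
  rw [map_sum]
  change ∑ᶠ p : List Bool × Cycle Bool, _ = ∑ c ∈ T, ∑ᶠ p : List Bool × Cycle Bool, _
  simp only [dIndet_sum, Finset.mul_sum, map_sum]
  refine finsum_sum_comm T _ fun c _ => ?_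
  refine ({c.R} ×ˢ c.Λ.toFinset : Finset (List Bool × Cycle Bool)).finite_toSet.subset
    fun p hp => ?_
  by_contra h
  refine hp ?_
  dsimp only
  rw [dIndet_g_dIndet_f_gammaTerm, mul_zero, map_zero]
  by_contra! h'
  exact h (Finset.mem_coe.2 (Finset.mem_product.2
    ⟨Finset.mem_singleton.2 h'.1, Multiset.mem_toFinset.2 h'.2⟩))

/-! ### The differential equation -/

/-- The cut-and-join operator `C'' + u² J''`. -/
def cutJoinOp (F : Series K) : Series K := cutOp F + var K .u ^ 2 * joinOp F

theorem coeff_mul_congr {A F G : Series K} {e : Var →₀ ℕ}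
    (h : ∀ e' ≤ e, MvPowerSeries.coeff e' F = MvPowerSeries.coeff e' G) :
    MvPowerSeries.coeff e (A * F) = MvPowerSeries.coeff e (A * G) := by
  classical
  rw [MvPowerSeries.coeff_mul, MvPowerSeries.coeff_mul]
  refine Finset.sum_congr rfl fun p hp => ?_
  rw [h p.2]
  rw [← Finset.HasAntidiagonal.mem_antidiagonal.1 hp]
  exact le_add_self

/-- A coefficient of the image under the cut-and-join operator depends only on the coefficients at
smaller exponents. -/
theorem coeff_cutJoinOp_congr {F G : Series K} {e : Var →₀ ℕ}
    (h : ∀ e' ≤ e, MvPowerSeries.coeff e' F = MvPowerSeries.coeff e' G) :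
    MvPowerSeries.coeff e (cutJoinOp F) = MvPowerSeries.coeff e (cutJoinOp G) := by
  rw [cutJoinOp, cutJoinOp, map_add, map_add]
  congr 1
  · refine finsum_congr fun R => coeff_mul_congr fun e' he' => ?_
    rw [coeff_dIndet, coeff_dIndet, h e' he']
  · refine coeff_mul_congr fun e' he' => ?_
    refine finsum_congr fun p => coeff_mul_congr fun e'' he'' => ?_
    simp only [coeff_dIndet, h e'' (he''.trans he')]

theorem cutJoinOp_sum_gammaTerm [CharZero K] (T : Finset Birooted) :
    cutJoinOp (∑ c ∈ T, gammaTerm K c) =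
      ∑ c ∈ T, ∑ x : Fin c.1, dv (gammaTerm K (Birooted.extend ⟨c, x⟩)) := by
  rw [cutJoinOp, cutOp_sum_gammaTerm, joinOp_sum_gammaTerm, Finset.mul_sum, ← Finset.sum_add_distrib]
  exact Finset.sum_congr rfl fun c _ => (sum_dv_gammaTerm_extend c).symm

/-- At a fixed exponent the left side involves dipoles with at most `N` edges and the right side
those with at most `N + 1`; `extend` matches them. -/
theorem cutJoinOp_Gam [CharZero K] : cutJoinOp (Gam K) = dv (Gam K) := by
  ext1 e
  set N := e Var.x + e Var.y + e Var.v + 1 with hN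
  have h1 : MvPowerSeries.coeff e (cutJoinOp (Gam K)) =
      MvPowerSeries.coeff e (cutJoinOp (∑ c ∈ dipolesUpTo N, gammaTerm K c)) := by
    refine coeff_cutJoinOp_congr fun e' he' => coeff_Gam ?_
    have := he' Var.x
    have := he' Var.y
    have := he' Var.v
    omega
  have h2 : MvPowerSeries.coeff e (dv (Gam K)) =
      ∑ c ∈ dipolesUpTo (N + 1), MvPowerSeries.coeff e (dv (gammaTerm K c)) := by
    rw [coeff_dv, coeff_Gam (N := N + 1), map_sum, Finset.smul_sum]
    · rfl
    · simp
      omega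
  rw [h1, h2, cutJoinOp_sum_gammaTerm, Finset.sum_sigma', map_sum]
  refine Finset.sum_of_injOn Birooted.extend Birooted.extend_injective.injOn ?_ ?_ ?_
  · rintro ⟨c, x⟩ h
    simp only [Finset.coe_sigma, Set.mem_sigma_iff, Finset.mem_coe, mem_dipolesUpTo] at h ⊢
    exact Nat.succ_le_succ h.1
  · intro c hc h
    -- A dipole outside the image of `extend` has no `c`- or `d`-edge, and its term is killed by the
    -- derivative.
    by_cases h0 : c.γ + c.δ = 0
    · rw [dv_gammaTerm_of_eq_zero K h0, map_zero]
    · obtain ⟨p, rfl⟩ := Birooted.exists_extend_eq h0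
      refine absurd ⟨p, ?_, rfl⟩ h
      rw [mem_dipolesUpTo] at hc
      simp only [Finset.coe_sigma, Set.mem_sigma_iff, Finset.mem_coe, mem_dipolesUpTo]
      exact ⟨Nat.le_of_succ_le_succ hc, Finset.mem_univ _⟩
  · intro p _
    rfl

/-! ### Initial condition and uniqueness -/

theorem bTerm_eq_gammaTerm {c : Birooted} (h : c.γ = 0 ∧ c.δ = 0) :
    bTerm K c = gammaTerm K c := by
  simp [bTerm, gammaTerm, h.1, h.2, invNat]

theorem atV0_Gam : atV0 (Gam K) = Bser K := by
  ext1 e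
  change (if e Var.v = 0 then ∑ᶠ c : Birooted, MvPowerSeries.coeff e (gammaTerm K c) else 0) =
    ∑ᶠ c : {c : Birooted // c.γ = 0 ∧ c.δ = 0}, MvPowerSeries.coeff e (bTerm K c.1)
  split_ifs with he
  · rw [finsum_subtype_eq_finsum_cond (f := fun c => MvPowerSeries.coeff e (bTerm K c))
      (p := fun c : Birooted => c.γ = 0 ∧ c.δ = 0)]
    refine finsum_congr fun c => ?_
    by_cases hc : c.γ = 0 ∧ c.δ = 0
    · rw [finsum_eq_if, if_pos hc, bTerm_eq_gammaTerm hc]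
    · rw [finsum_eq_if, if_neg hc]
      refine coeff_gammaTerm_of_ne ?_
      rintro rfl
      rw [gammaExp_v] at he
      omega
  · symm
    apply finsum_eq_zero_of_forall_eq_zero
    rintro ⟨c, hc⟩
    rw [bTerm_eq_gammaTerm hc]
    refine coeff_gammaTerm_of_ne ?_
    rintro rfl
    rw [gammaExp_v] at he
    omega

/-- The operator never lowers exponents, so the equation expresses `n + 1` times a coefficient of
`v`-degree `n + 1` through coefficients of `v`-degree at most `n`; degree 0 is the initial
condition. -/
theorem IsSolution.unique [CharZero K] {F G : Series K} (hF : IsSolution F) (hG : IsSolution G) :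
    F = G := by
  have key : ∀ n : ℕ, ∀ e : Var →₀ ℕ, e Var.v = n →
      MvPowerSeries.coeff e F = MvPowerSeries.coeff e G := by
    intro n
    induction n using Nat.strong_induction_on with
    | h n ih =>
      intro e he
      cases n with
      | zero =>
        have h : ∀ H : Series K, MvPowerSeries.coeff e (atV0 H) = MvPowerSeries.coeff e H :=
          fun H => if_pos he
        rw [← h F, ← h G, hF.2, hG.2]
      | succ n =>
        set e₀ := e - Finsupp.single Var.v 1 with he₀
        have h0 : e₀ Var.v = n := by simp [he₀, he]
        have h1 : e₀ + Finsupp.single Var.v 1 = e := by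
          rw [he₀, tsub_add_cancel_of_le]
          rw [Finsupp.single_le_iff]
          omega
        have h2 : MvPowerSeries.coeff e₀ (cutJoinOp F) = MvPowerSeries.coeff e₀ (cutJoinOp G) :=
          coeff_cutJoinOp_congr fun e' he' => ih (e' Var.v)
            (by have := he' Var.v; omega) e' rfl
        rw [cutJoinOp, cutJoinOp, hF.1, hG.1, coeff_dv, coeff_dv, h1, nsmul_eq_mul,
          nsmul_eq_mul] at h2
        exact mul_left_cancel₀ (Nat.cast_ne_zero.2 (Nat.succ_ne_zero _)) h2
  ext1 e
  exact key _ e rfl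

theorem isSolution_Gam [CharZero K] : IsSolution (Gam K) := ⟨cutJoinOp_Gam, atV0_Gam⟩

end DipoleSeries

end

theorem theorem2 (K : Type*) [Field K] [CharZero K] :
    DipoleSeries.IsSolution (DipoleSeries.Gam K) ∧
      ∀ F : DipoleSeries.Series K, DipoleSeries.IsSolution F → F = DipoleSeries.Gam K := by
  exact ⟨DipoleSeries.isSolution_Gam, fun _ hF => hF.unique DipoleSeries.isSolution_Gam⟩
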